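/- All trees are leaf-labelled rooted binary trees (not planar), including the trees with a single leaf and no inner vertex; a forest on a finite set $I$ is a set of trees whose sets of leaf labels form a partition of $I$. For a forest $F$ on $I$, its support $\operatorname{Supp}(F)\subseteq I$ is the set of leaves whose path to the root contains at least one inner vertex. Let $\operatorname{Bess}(I)$ be the $\mathbb{Q}$-vector space spanned by the oriented forests $o\otimes F$, where $F$ is a forest on $I$ and $o$ is an orientation of $I$ tensor an orientation of the set of roots of $F$ (an orientation of a finite set being a generator of its top exterior power), with $(-o)\otimes F=-(o\otimes F)$. These spaces form the Bessel operad $\operatorname{Bess}=\operatorname{Det}\otimes B$. Here $\operatorname{Det}$ is the suspended commutative operad, and $B$ is the operad of root-oriented forests, generated by an antisymmetric element $e_{i,j}$ of degree $1$ (disjoint union) and a symmetric element $\omega_{i,j}$ of degree $0$ (grafting), with relations $e_{i,\star}\circ_\star e_{j,k}=e_{k,\star}\circ_\star e_{i,j}$ and $\omega_{i,\star}\circ_\star e_{j,k}=e_{j,\star}\circ_\star\omega_{i,k}-e_{k,\star}\circ_\star\omega_{i,j}$. The operad $\operatorname{Bess}$ is generated by $E_{i,j}=(j\wedge i)\otimes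 e_{i,j}$ and $\Omega_{i,j}=(i\wedge j)\otimes\omega_{i,j}$, and it is graded by the number of inner vertices. It is a Hopf operad, with the morphism of operads $\Delta:\operatorname{Bess}\to\operatorname{Bess}\otimes\operatorname{Bess}$ determined by $\Delta(E_{i,j})=E_{i,j}\otimes E_{i,j}$ and $\Delta(\Omega_{i,j})=E_{i,j}\otimes\Omega_{i,j}+\Omega_{i,j}\otimes E_{i,j}$ (with Koszul signs). So the dual space $\operatorname{Bess}^*(I)$ is an algebra for the opposite of the dual product, $\langle f\times g,x\rangle=\sum\langle f,x'\rangle\langle g,x''\rangle$ where $\Delta(x)=\sum x'\otimes x''$. It has the dual basis, still indexed by the forests on $I$, one orientation being chosen for each: the element $o\otimes F$ of $\operatorname{Bess}^*(I)$ takes the value $1$ on $o\otimes F$ and $0$ on $o'\otimes F'$ for $F'\neq F$. A forest appears in an element of $\operatorname{Bess}^*(I)$ if its coefficient in this basis is not zero. **Proposition.** Let $F_1$ and $F_2$ be two forests on $I$ with $\operatorname{Supp}(F_1)\cap\operatorname{Supp}(F_2)=\emptyset$. Then there is exactly one forest $F$ on $I$ such that $\operatorname{Supp}(F)=\operatorname{Supp}(F_1)\sqcup\operatorname{Supp}(F_2)$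 and such that $F$ coincides with $F_1$ on $\operatorname{Supp}(F_1)$ and with $F_2$ on $\operatorname{Supp}(F_2)$; that is, for $a=1,2$, the trees of $F$ with all their leaves in $\operatorname{Supp}(F_a)$ are the trees of $F_a$ with all their leaves in $\operatorname{Supp}(F_a)$. For all orientations $o_1$ of $F_1$ and $o_2$ of $F_2$, this forest $F$ appears in the product $(o_1\otimes F_1)\times(o_2\otimes F_2)$ in $\operatorname{Bess}^*(I)$, and no other forest appears in it. -/

import Mathlib

open scoped TensorProduct

namespace Bessel

section Trees

variable {ι : Type*} [DecidableEq ι]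

/-- `IsBinaryTree A N`: the family `N` is the set of vertices of a (non-planar) rooted binary tree
whose leaves are labelled bijectively by the nonempty finite set `A`.  A vertex (leaf or inner
vertex) is recorded by the set of the leaves above it; thus the leaf `i` is `{i}`, an inner vertex
is a set with at least two elements, and the vertices on the path from the leaf `i` down to the
root are the members of `N` that contain `i`. -/
inductive IsBinaryTree : Finset ι → Finset (Finset ι) → Prop
  | leaf (i : ι) : IsBinaryTree {i} {{i}}
  | graft {A B : Finset ι} {N M : Finset (Finset ι)} (h : Disjoint A B)
      (hA : IsBinaryTree A N) (hB : IsBinaryTree B M) :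
      IsBinaryTree (A ∪ B) (insert (A ∪ B) (N ∪ M))

variable (ι) in
/-- Leaf-labelled rooted binary trees, with leaf labels in `ι`. -/
@[ext]
structure LTree where
  /-- the set of leaf labels -/
  leaves : Finset ι
  /-- the leaves and the inner vertices, each given by the leaves above it -/
  vertices : Finset (Finset ι)
  isTree : IsBinaryTree leaves vertices

namespace LTree

instance : DecidableEq (LTree ι) := fun a b =>
  decidable_of_iff (a.leaves = b.leaves ∧ a.vertices = b.vertices) LTree.ext_iff.symm

noncomputable instance [Fintype ι] : Fintype (LTree ι) :=
  Fintype.ofInjective (fun T : LTree ι => (T.leaves, T.vertices)) fun a b h => by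
    simp only [Prod.mk.injEq] at h
    exact LTree.ext h.1 h.2

/-- The tree with a single leaf and no inner vertex. -/
def leaf (i : ι) : LTree ι := ⟨{i}, {{i}}, .leaf i⟩

/-- The grafting `T ∨ S` of two trees on the two leaves of the tree with one inner vertex. -/
def graft (T S : LTree ι) (h : Disjoint T.leaves S.leaves) : LTree ι :=
  ⟨T.leaves ∪ S.leaves, insert (T.leaves ∪ S.leaves) (T.vertices ∪ S.vertices),
    .graft h T.isTree S.isTree⟩

theorem leaves_nonempty (T : LTree ι) : T.leaves.Nonempty := by
  obtain ⟨A, N, h⟩ := T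
  show A.Nonempty
  induction h with
  | leaf i => exact ⟨i, by simp⟩
  | graft h hA hB ih1 ih2 => exact ih1.mono Finset.subset_union_left

end LTree

/-- A forest on the finite set `J`: a set of binary trees whose leaf sets form a partition
of `J`. -/
@[ext]
structure Forest (J : Finset ι) where
  trees : Finset (LTree ι)
  disjoint : ∀ T ∈ trees, ∀ S ∈ trees, T ≠ S → Disjoint T.leaves S.leaves
  cover : trees.biUnion LTree.leaves = J

namespace Forest

variable {J K : Finset ι}

instance : DecidableEq (Forest J) := fun a b =>
  decidable_of_iff (a.trees = b.trees) Forest.ext_iff.symm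

noncomputable instance [Fintype ι] : Fintype (Forest J) :=
  Fintype.ofInjective (fun F : Forest J => F.trees) fun _ _ h => Forest.ext h

/-- The support: the leaves `i` such that the path from `i` to the root contains at least one
inner vertex. -/
def support (F : Forest J) : Finset ι :=
  J.filter fun i => ∃ T ∈ F.trees, ∃ v ∈ T.vertices, i ∈ v ∧ 2 ≤ v.card

/-- The part of the forest `F` that lives on the set of leaves `S`: the trees of `F` all of whose
leaves belong to `S`. -/
def on (F : Forest J) (S : Finset ι) : Finset (LTree ι) :=
  F.trees.filter fun T => T.leaves ⊆ S

/-- `F` is a forest with `Supp F = Supp F₁ ∪ Supp F₂` that coincides with `F₁` on `Supp F₁` and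
with `F₂` on `Supp F₂`. -/
def IsUnionOf (F F₁ F₂ : Forest J) : Prop :=
  F.support = F₁.support ∪ F₂.support ∧
    F.on F₁.support = F₁.on F₁.support ∧ F.on F₂.support = F₂.on F₂.support

theorem leaves_subset (F : Forest J) {T : LTree ι} (hT : T ∈ F.trees) : T.leaves ⊆ J := by
  rw [← F.cover]
  exact Finset.subset_biUnion_of_mem LTree.leaves hT

/-- The disjoint union of two forests. -/
def union (h : Disjoint J K) (F : Forest J) (G : Forest K) : Forest (J ∪ K) where
  trees := F.trees ∪ G.trees
  disjoint := by
    intro T hT S hS hTS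
    rcases Finset.mem_union.1 hT with hT | hT <;> rcases Finset.mem_union.1 hS with hS | hS
    · exact F.disjoint T hT S hS hTS
    · exact Disjoint.mono (F.leaves_subset hT) (G.leaves_subset hS) h
    · exact Disjoint.mono (G.leaves_subset hT) (F.leaves_subset hS) h.symm
    · exact G.disjoint T hT S hS hTS
  cover := by rw [Finset.union_biUnion, F.cover, G.cover]

theorem leaves_disjoint (h : Disjoint J K) (F : Forest J) (G : Forest K) {T S : LTree ι}
    (hT : T ∈ F.trees) (hS : S ∈ G.trees) : Disjoint T.leaves S.leaves :=
  Disjoint.mono (F.leaves_subset hT) (G.leaves_subset hS) h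

theorem trees_disjoint (h : Disjoint J K) (F : Forest J) (G : Forest K) :
    Disjoint F.trees G.trees := by
  rw [Finset.disjoint_left]
  intro T hT hT'
  obtain ⟨i, hi⟩ := T.leaves_nonempty
  exact (Finset.disjoint_left.1 (leaves_disjoint h F G hT hT')) hi hi

/-- The disjoint union of `F` and `G`, with a tree `T` of `F` and a tree `S` of `G` replaced by
`T ∨ S`. -/
def graftAt (h : Disjoint J K) (F : Forest J) (G : Forest K) (T S : LTree ι)
    (hT : T ∈ F.trees) (hS : S ∈ G.trees) : Forest (J ∪ K) where
  trees := insert (T.graft S (leaves_disjoint h F G hT hS)) (F.trees.erase T ∪ G.trees.erase S)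
  disjoint := by
    have key : ∀ U ∈ F.trees.erase T ∪ G.trees.erase S,
        Disjoint (T.leaves ∪ S.leaves) U.leaves := by
      intro U hU
      rw [Finset.disjoint_union_left]
      rcases Finset.mem_union.1 hU with hU | hU
      · have hU' := Finset.mem_erase.1 hU
        exact ⟨F.disjoint T hT U hU'.2 hU'.1.symm, (leaves_disjoint h F G hU'.2 hS).symm⟩
      · have hU' := Finset.mem_erase.1 hU
        exact ⟨leaves_disjoint h F G hT hU'.2, G.disjoint S hS U hU'.2 hU'.1.symm⟩
    intro U hU V hV hUV
    rcases Finset.mem_insert.1 hU with hU1 | hU1 <;> rcases Finset.mem_insert.1 hV with hV1 | hV1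
    · exact absurd (hU1.trans hV1.symm) hUV
    · rw [hU1]; exact key V hV1
    · rw [hV1]; exact (key U hU1).symm
    · have sub : F.trees.erase T ∪ G.trees.erase S ⊆ (union h F G).trees :=
        Finset.union_subset_union (Finset.erase_subset _ _) (Finset.erase_subset _ _)
      exact (union h F G).disjoint U (sub hU1) V (sub hV1) hUV
  cover := by
    have e1 : T.leaves ∪ (F.trees.erase T).biUnion LTree.leaves = J := by
      rw [← Finset.biUnion_insert, Finset.insert_erase hT, F.cover]
    have e2 : S.leaves ∪ (G.trees.erase S).biUnion LTree.leaves = K := by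
      rw [← Finset.biUnion_insert, Finset.insert_erase hS, G.cover]
    rw [Finset.biUnion_insert, Finset.union_biUnion]
    conv_rhs => rw [← e1, ← e2]
    exact Finset.union_union_union_comm _ _ _ _

/-- An (outer) orientation of a forest `F` on `J`, that is, an orientation of `J` tensor an
orientation of the set of roots of `F`; equivalently, an orientation of the disjoint union of `J`
and of the set of roots.  It is given by listing the elements of this disjoint union, each exactly
once, and the list stands for the exterior product of its entries; a root is identified with
its tree. -/
structure Orientation (F : Forest J) where
  list : List (ι ⊕ LTree ι)
  nodup : list.Nodup
  mem_iff : ∀ g, g ∈ list ↔ g ∈ J.disjSum F.trees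

end Forest

end Trees

section Ext

variable (ι : Type*) [DecidableEq ι]

/-- The exterior algebra over `ℚ` on the disjoint union of the set of labels and of the set of
trees (that is, of their roots). -/
abbrev Ext := ExteriorAlgebra ℚ ((ι ⊕ LTree ι) →₀ ℚ)

variable {ι}

/-- A label or a root as an element of the exterior algebra. -/
noncomputable def gen (g : ι ⊕ LTree ι) : Ext ι := ExteriorAlgebra.ι ℚ (Finsupp.single g 1)

/-- The exterior product of the entries of a list. -/
noncomputable def word (L : List (ι ⊕ LTree ι)) : Ext ι := (L.map gen).prod

/-- The grading involution: `1` in even degree and `-1` in odd degree. -/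
noncomputable def inv : Ext ι →ₗ[ℚ] Ext ι := (CliffordAlgebra.involute).toLinearMap

/-- The interior product (left contraction, "partial derivative") with respect to `g`:
`g ∧ g₂ ∧ ⋯ ∧ gₙ` is sent to `g₂ ∧ ⋯ ∧ gₙ`. -/
noncomputable def del (g : ι ⊕ LTree ι) : Ext ι →ₗ[ℚ] Ext ι :=
  CliffordAlgebra.contractLeft (Finsupp.lapply g)

/-- The coefficient of `g₁ ∧ ⋯ ∧ gₙ` (for `gᵢ` distinct) in an element of the exterior algebra. -/
noncomputable def coeff : List (ι ⊕ LTree ι) → Ext ι →ₗ[ℚ] ℚ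
  | [] => (ExteriorAlgebra.algebraMapInv).toLinearMap
  | g :: L => coeff L ∘ₗ del g

/-- The bilinear operation `x, y ↦ ∑ (T ∨ S) ∧ ∂_T (inv x) ∧ ∂_S y`, the sum being over the pairs
of trees with disjoint sets of leaves. -/
noncomputable def bracket [Fintype ι] : Ext ι →ₗ[ℚ] Ext ι →ₗ[ℚ] Ext ι :=
  ∑ T : LTree ι, ∑ S : LTree ι,
    if h : Disjoint T.leaves S.leaves then
      (LinearMap.mul ℚ (Ext ι)).compl₁₂
        (LinearMap.mulLeft ℚ (gen (Sum.inr (T.graft S h))) ∘ₗ del (Sum.inr T) ∘ₗ inv)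
        (del (Sum.inr S))
    else 0

theorem gen_mul_gen (a b : ι ⊕ LTree ι) : gen a * gen b = -(gen b * gen a) := by
  rw [eq_neg_iff_add_eq_zero]
  exact ExteriorAlgebra.ι_add_mul_swap _ _

theorem word_cons (g : ι ⊕ LTree ι) (L) : word (g :: L) = gen g * word L := by
  simp [word]

theorem word_append (L L' : List (ι ⊕ LTree ι)) : word (L ++ L') = word L * word L' := by
  simp [word]

theorem word_perm {L L' : List (ι ⊕ LTree ι)} (h : L.Perm L') :
    word L = word L' ∨ word L = -word L' := by
  induction h with
  | nil => exact Or.inl rfl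
  | cons x _ ih =>
    rw [word_cons, word_cons]
    rcases ih with ih | ih <;> simp [ih]
  | swap x y l =>
    right
    rw [word_cons, word_cons, word_cons, word_cons, ← mul_assoc, gen_mul_gen, neg_mul, mul_assoc]
  | trans _ _ ih1 ih2 =>
    rcases ih1 with ih1 | ih1 <;> rcases ih2 with ih2 | ih2 <;> simp [ih1, ih2]

theorem inv_word (L : List (ι ⊕ LTree ι)) : inv (word L) = word L ∨ inv (word L) = -word L := by
  induction L with
  | nil => left; simp [word, inv]
  | cons g L ih =>
    have e : inv (word (g :: L)) = -gen g * inv (word L) := by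
      rw [word_cons]
      simp [inv, gen]
    rcases ih with ih | ih <;> rw [e, ih, word_cons] <;> simp

theorem del_gen_mul (g a : ι ⊕ LTree ι) (x : Ext ι) :
    del g (gen a * x) = (if a = g then x else 0) - gen a * del g x := by
  have := CliffordAlgebra.contractLeft_ι_mul (Q := (0 : QuadraticForm ℚ ((ι ⊕ LTree ι) →₀ ℚ)))
    (Finsupp.lapply g) (Finsupp.single a (1 : ℚ)) x
  refine this.trans ?_
  congr 1
  simp only [Finsupp.lapply_apply, Finsupp.single_apply]
  split_ifs <;> simp

theorem del_word_of_notMem {g : ι ⊕ LTree ι} {L : List (ι ⊕ LTree ι)} (h : g ∉ L) :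
    del g (word L) = 0 := by
  induction L with
  | nil => simp [word, del]
  | cons a L ih =>
    simp only [List.mem_cons, not_or] at h
    rw [word_cons, del_gen_mul, if_neg (Ne.symm h.1), ih h.2]
    simp

theorem del_word_of_perm {g : ι ⊕ LTree ι} {L L' : List (ι ⊕ LTree ι)} (hL : L.Nodup)
    (h : L.Perm (g :: L')) : del g (word L) = word L' ∨ del g (word L) = -word L' := by
  have hg : g ∉ L' := (List.nodup_cons.1 (h.nodup_iff.1 hL)).1
  have e : del g (word (g :: L')) = word L' := by
    rw [word_cons, del_gen_mul, if_pos rfl, del_word_of_notMem hg]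
    simp
  rcases word_perm h with h' | h' <;> rw [h'] <;> simp [e]

end Ext

section Bess

variable {ι : Type*} [DecidableEq ι] {J K : Finset ι}

/-- The space `Bess(J)`, spanned by the oriented forests `o ⊗ F` on `J`, i.e. by the exterior
products `o = g₁ ∧ ⋯ ∧ gₙ` where `g₁, …, gₙ` is a list of the elements of `J` and of the roots of
a forest `F` on `J`. -/
noncomputable def Bess (J : Finset ι) : Submodule ℚ (Ext ι) :=
  Submodule.span ℚ {x | ∃ (F : Forest J) (o : F.Orientation), word o.list = x}

/-- The oriented forest `o ⊗ F` as an element of `Bess(J)`. -/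
noncomputable def Forest.Orientation.elt {F : Forest J} (o : F.Orientation) : Bess J :=
  ⟨word o.list, Submodule.subset_span ⟨F, o, rfl⟩⟩

theorem word_mem {F : Forest J} {L : List (ι ⊕ LTree ι)} (h : L.Nodup)
    (h' : ∀ g, g ∈ L ↔ g ∈ J.disjSum F.trees) : word L ∈ Bess J :=
  Submodule.subset_span ⟨F, ⟨L, h, h'⟩, rfl⟩

theorem inv_mem {x : Ext ι} (hx : x ∈ Bess J) : inv x ∈ Bess J := by
  have : (Bess J).map inv ≤ Bess J := by
    rw [Bess, Submodule.map_span, Submodule.span_le]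
    rintro _ ⟨_, ⟨F, o, rfl⟩, rfl⟩
    rcases inv_word o.list with h | h <;> rw [h]
    · exact word_mem o.nodup o.mem_iff
    · exact neg_mem (word_mem o.nodup o.mem_iff)
  exact this (Submodule.mem_map_of_mem hx)

theorem mul_mem_Bess (h : Disjoint J K) {x y : Ext ι} (hx : x ∈ Bess J) (hy : y ∈ Bess K) :
    LinearMap.mul ℚ (Ext ι) x y ∈ Bess (J ∪ K) := by
  have : Submodule.map₂ (LinearMap.mul ℚ (Ext ι)) (Bess J) (Bess K) ≤ Bess (J ∪ K) := by
    rw [Bess, Bess, Submodule.map₂_span_span, Submodule.span_le]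
    rintro _ ⟨_, ⟨F, o, rfl⟩, _, ⟨G, p, rfl⟩, rfl⟩
    simp only [LinearMap.mul_apply', SetLike.mem_coe]
    rw [← word_append]
    refine word_mem (F := F.union h G) (List.Nodup.append o.nodup p.nodup ?_) ?_
    · intro g hg hg'
      rw [o.mem_iff] at hg
      rw [p.mem_iff] at hg'
      rcases g with i | T
      · simp only [Finset.inl_mem_disjSum] at hg hg'
        exact Finset.disjoint_left.1 h hg hg'
      · simp only [Finset.inr_mem_disjSum] at hg hg'
        exact Finset.disjoint_left.1 (Forest.trees_disjoint h F G) hg hg'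
    · intro g
      rw [List.mem_append, o.mem_iff, p.mem_iff]
      rcases g with i | T <;> simp [Forest.union]
  exact this (Submodule.apply_mem_map₂ _ hx hy)

theorem bracket_mem [Fintype ι] (h : Disjoint J K) {x y : Ext ι} (hx : x ∈ Bess J)
    (hy : y ∈ Bess K) : bracket x y ∈ Bess (J ∪ K) := by
  have : Submodule.map₂ (bracket (ι := ι)) (Bess J) (Bess K) ≤ Bess (J ∪ K) := by
    rw [Bess, Bess, Submodule.map₂_span_span, Submodule.span_le]
    rintro _ ⟨_, ⟨F, o, rfl⟩, _, ⟨G, p, rfl⟩, rfl⟩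
    simp only [bracket, LinearMap.sum_apply, SetLike.mem_coe]
    refine Submodule.sum_mem _ fun T _ => Submodule.sum_mem _ fun S _ => ?_
    split_ifs with hTS
    swap
    · simp
    simp only [LinearMap.compl₁₂_apply, LinearMap.mul_apply', LinearMap.comp_apply,
      LinearMap.mulLeft_apply]
    have pm : ∀ {a b : Ext ι}, a = b ∨ a = -b → b ∈ Bess (J ∪ K) → a ∈ Bess (J ∪ K) := by
      rintro a b (rfl | rfl) hb
      · exact hb
      · exact neg_mem hb
    by_cases hT : T ∈ F.trees
    swap
    · have hT' : (Sum.inr T : ι ⊕ LTree ι) ∉ o.list := by simpa [o.mem_iff] using hT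
      rcases inv_word o.list with e | e <;> rw [e] <;> simp [del_word_of_notMem hT']
    by_cases hS : S ∈ G.trees
    swap
    · have hS' : (Sum.inr S : ι ⊕ LTree ι) ∉ p.list := by simpa [p.mem_iff] using hS
      simp [del_word_of_notMem hS']
    have hT' : (Sum.inr T : ι ⊕ LTree ι) ∈ o.list := by simpa [o.mem_iff] using hT
    have hS' : (Sum.inr S : ι ⊕ LTree ι) ∈ p.list := by simpa [p.mem_iff] using hS
    obtain ⟨a, b, hab⟩ := List.append_of_mem hT'
    obtain ⟨c, d, hcd⟩ := List.append_of_mem hS'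
    have h1 : o.list.Perm (Sum.inr T :: (a ++ b)) := by rw [hab]; exact List.perm_middle
    have h2 : p.list.Perm (Sum.inr S :: (c ++ d)) := by rw [hcd]; exact List.perm_middle
    have n1 := List.nodup_cons.1 (h1.nodup_iff.1 o.nodup)
    have n2 := List.nodup_cons.1 (h2.nodup_iff.1 p.nodup)
    have m1 : ∀ g, g ∈ a ++ b ↔ g ∈ J.disjSum (F.trees.erase T) := by
      intro g
      have := (h1.mem_iff (a := g)).symm.trans (o.mem_iff g)
      rw [List.mem_cons] at this
      rcases g with i | U
      · simpa using this
      · by_cases e : U = T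
        · subst e; simpa using n1.1
        · simpa [e] using this
    have m2 : ∀ g, g ∈ c ++ d ↔ g ∈ K.disjSum (G.trees.erase S) := by
      intro g
      have := (h2.mem_iff (a := g)).symm.trans (p.mem_iff g)
      rw [List.mem_cons] at this
      rcases g with i | U
      · simpa using this
      · by_cases e : U = S
        · subst e; simpa using n2.1
        · simpa [e] using this
    have key : word (Sum.inr (T.graft S hTS) :: ((a ++ b) ++ (c ++ d))) ∈ Bess (J ∪ K) := by
      refine word_mem (F := F.graftAt h G T S hT hS) ?_ ?_
      · refine List.nodup_cons.2 ⟨?_, List.Nodup.append n1.2 n2.2 ?_⟩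
        · rw [List.mem_append, m1, m2]
          obtain ⟨i, hi⟩ := T.leaves_nonempty
          obtain ⟨j, hj⟩ := S.leaves_nonempty
          simp only [Finset.inr_mem_disjSum, Finset.mem_erase, not_or, not_and]
          constructor
          · intro _ hm
            exact Finset.disjoint_left.1 h (F.leaves_subset hm (Finset.mem_union_right _ hj))
              (G.leaves_subset hS hj)
          · intro _ hm
            exact Finset.disjoint_left.1 h (F.leaves_subset hT hi)
              (G.leaves_subset hm (Finset.mem_union_left _ hi))
        · intro g hg hg'
          rw [m1] at hg
          rw [m2] at hg'
          rcases g with i | U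
          · simp only [Finset.inl_mem_disjSum] at hg hg'
            exact Finset.disjoint_left.1 h hg hg'
          · simp only [Finset.inr_mem_disjSum, Finset.mem_erase] at hg hg'
            exact Finset.disjoint_left.1 (Forest.trees_disjoint h F G) hg.2 hg'.2
      · intro g
        rw [List.mem_cons, List.mem_append, m1, m2]
        rcases g with i | U <;> simp [Forest.graftAt]
    refine pm ?_ key
    rw [word_cons, word_append]
    rcases inv_word o.list with e | e <;> rcases del_word_of_perm o.nodup h1 with e1 | e1 <;>
      rcases del_word_of_perm p.nodup h2 with e2 | e2 <;> simp [e, e1, e2, mul_assoc]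
  exact this (Submodule.apply_mem_map₂ _ hx hy)

/-- The Koszul parity operator on `Bess(J)`: `x ↦ (-1)^|x| x`.  An oriented forest on `J` is an
exterior product of `|J|` labels and of the roots, so the parity of its exterior degree is that of
`|J|` minus the number of roots, which is the number of inner vertices. -/
noncomputable def parity (J : Finset ι) : Bess J →ₗ[ℚ] Bess J :=
  inv.restrict fun _ hx => inv_mem hx

/-- The restriction of a bilinear operation of the exterior algebra. -/
noncomputable def restrict₂ {J K L : Finset ι} (f : Ext ι →ₗ[ℚ] Ext ι →ₗ[ℚ] Ext ι)
    (hf : ∀ x ∈ Bess J, ∀ y ∈ Bess K, f x y ∈ Bess L) : Bess J ⊗[ℚ] Bess K →ₗ[ℚ] Bess L :=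
  TensorProduct.lift <| LinearMap.mk₂ ℚ (fun x y => ⟨f x y, hf x x.2 y y.2⟩)
    (fun _ _ _ => Subtype.ext (by simp)) (fun _ _ _ => Subtype.ext (by simp))
    (fun _ _ _ => Subtype.ext (by simp)) (fun _ _ _ => Subtype.ext (by simp))

/-- The action of the generator `E` of the operad, `x ⊗ y ↦ E_{⋆,#} ∘_⋆ x ∘_# y`.  On oriented
forests it is `(o₁ ⊗ F₁) ⊗ (o₂ ⊗ F₂) ↦ (o₁ ∧ o₂) ⊗ (F₁ ⊔ F₂)`. -/
noncomputable def opE (h : Disjoint J K) : Bess J ⊗[ℚ] Bess K →ₗ[ℚ] Bess (J ∪ K) :=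
  restrict₂ (LinearMap.mul ℚ (Ext ι)) fun _ hx _ hy => mul_mem_Bess h hx hy

/-- The action of the generator `Ω` of the operad, `x ⊗ y ↦ Ω_{⋆,#} ∘_⋆ x ∘_# y`.  On oriented
forests it is `(o₁ ⊗ F₁) ⊗ (o₂ ⊗ F₂) ↦ ± ∑ F`, the sum being over all the ways to replace, in
`F₁ ⊔ F₂`, a tree `T` of `F₁` and a tree `S` of `F₂` by `T ∨ S`. In particular the sign is such that
`(a ∧ T) ⊗ (b ∧ S) ↦ (-1)^(|A| - 1) a ∧ b ∧ (T ∨ S)` where `a`, `b` are orientations of the sets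
of leaves `A`, `B` of the trees `T`, `S`; it is antisymmetric and is a derivation of degree one
with respect to `E`. -/
noncomputable def opΩ [Fintype ι] (h : Disjoint J K) : Bess J ⊗[ℚ] Bess K →ₗ[ℚ] Bess (J ∪ K) :=
  restrict₂ bracket fun _ hx _ hy => bracket_mem h hx hy

/-- The Koszul symmetry `x ⊗ y ↦ (-1)^(|x| |y|) y ⊗ x`, which on homogeneous elements is
`y ⊗ x` if `x` or `y` is even and `- y ⊗ x` if both are odd. -/
noncomputable def braid (J K : Finset ι) : Bess J ⊗[ℚ] Bess K →ₗ[ℚ] Bess K ⊗[ℚ] Bess J :=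
  ((1 / 2 : ℚ) • (LinearMap.id + TensorProduct.map (parity K) LinearMap.id
    + TensorProduct.map LinearMap.id (parity J) + TensorProduct.map (parity K) (-parity J)))
    ∘ₗ (TensorProduct.comm ℚ (Bess J) (Bess K)).toLinearMap

/-- The map `(x' ⊗ x'') ⊗ (y' ⊗ y'') ↦ (-1)^(|x''| |y'|) P (x' ⊗ y') ⊗ Q (x'' ⊗ y'')`. -/
noncomputable def tensorOp (P Q : Bess J ⊗[ℚ] Bess K →ₗ[ℚ] Bess (J ∪ K)) :
    (Bess J ⊗[ℚ] Bess J) ⊗[ℚ] (Bess K ⊗[ℚ] Bess K) →ₗ[ℚ] Bess (J ∪ K) ⊗[ℚ] Bess (J ∪ K) :=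
  TensorProduct.map P Q
    ∘ₗ (TensorProduct.tensorTensorTensorAssoc ℚ (Bess J) (Bess K) (Bess J) (Bess K)).symm
    ∘ₗ TensorProduct.map (TensorProduct.map LinearMap.id (braid J K)) LinearMap.id
    ∘ₗ (TensorProduct.tensorTensorTensorAssoc ℚ (Bess J) (Bess J) (Bess K) (Bess K)).toLinearMap

/-- The action of `Δ(E) = E ⊗ E` in the operad `Bess ⊗ Bess`. -/
noncomputable def deltaE (h : Disjoint J K) :
    (Bess J ⊗[ℚ] Bess J) ⊗[ℚ] (Bess K ⊗[ℚ] Bess K) →ₗ[ℚ] Bess (J ∪ K) ⊗[ℚ] Bess (J ∪ K) :=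
  tensorOp (opE h) (opE h)

/-- The action of `Δ(Ω) = E ⊗ Ω + Ω ⊗ E` in the operad `Bess ⊗ Bess`; in the first summand, `Ω`,
which is of degree one, moves past `x'` and `y'`. -/
noncomputable def deltaΩ [Fintype ι] (h : Disjoint J K) :
    (Bess J ⊗[ℚ] Bess J) ⊗[ℚ] (Bess K ⊗[ℚ] Bess K) →ₗ[ℚ] Bess (J ∪ K) ⊗[ℚ] Bess (J ∪ K) :=
  tensorOp (opE h ∘ₗ TensorProduct.map (parity J) (parity K)) (opΩ h)
    + tensorOp (opΩ h) (opE h)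

/-- The monomials in the generator `Ω` alone (planar binary trees). -/
inductive TreeMonomial : Finset ι → Type _
  | leaf (i : ι) : TreeMonomial {i}
  | node {J K : Finset ι} (h : Disjoint J K) (s : TreeMonomial J) (t : TreeMonomial K) :
      TreeMonomial (J ∪ K)

/-- The iterated products under the generator `E` of monomials in `Ω` (the empty product is
allowed for the empty set of labels). -/
inductive ForestMonomial : Finset ι → Type _
  | nil : ForestMonomial ∅
  | cons {J K : Finset ι} (h : Disjoint J K) (s : TreeMonomial J) (t : ForestMonomial K) :
      ForestMonomial (J ∪ K)

/-- The forest with the single tree `T`. -/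
def LTree.toForest (T : LTree ι) : Forest T.leaves :=
  ⟨{T}, by simp, by simp⟩

/-- The unit of the operad: the tree with one leaf `i` and no inner vertex, with outer
orientation `i ⊗ root`. -/
noncomputable def unitElt (i : ι) : Bess ({i} : Finset ι) :=
  Forest.Orientation.elt (F := (LTree.leaf i).toForest)
    ⟨[Sum.inl i, Sum.inr (LTree.leaf i)], by simp, by
      rintro (j | T) <;> simp [LTree.toForest, LTree.leaf]⟩

/-- The empty forest. -/
noncomputable def emptyElt : Bess (∅ : Finset ι) :=
  Forest.Orientation.elt (F := ⟨∅, by simp, by simp⟩) ⟨[], by simp, by simp⟩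

/-- The value in the operad `Bess` of a monomial in `Ω`. -/
noncomputable def TreeMonomial.eval [Fintype ι] : {J : Finset ι} → TreeMonomial J → Bess J
  | _, .leaf i => unitElt i
  | _, .node h s t => opΩ h (s.eval ⊗ₜ t.eval)

/-- The value of a monomial in the operad `Bess`. -/
noncomputable def ForestMonomial.eval [Fintype ι] : {J : Finset ι} → ForestMonomial J → Bess J
  | _, .nil => emptyElt
  | _, .cons h s t => opE h (s.eval ⊗ₜ t.eval)

/-- The value in the operad `Bess ⊗ Bess` of a monomial, `Ω` being replaced by `Δ(Ω)`. -/
noncomputable def TreeMonomial.delta [Fintype ι] :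
    {J : Finset ι} → TreeMonomial J → Bess J ⊗[ℚ] Bess J
  | _, .leaf i => unitElt i ⊗ₜ unitElt i
  | _, .node h s t => deltaΩ h (s.delta ⊗ₜ t.delta)

/-- The value in the operad `Bess ⊗ Bess` of a monomial, `E` and `Ω` being replaced by `Δ(E)` and
`Δ(Ω)`. -/
noncomputable def ForestMonomial.delta [Fintype ι] :
    {J : Finset ι} → ForestMonomial J → Bess J ⊗[ℚ] Bess J
  | _, .nil => emptyElt ⊗ₜ emptyElt
  | _, .cons h s t => deltaE h (s.delta ⊗ₜ t.delta)

theorem coe_unitElt (i : ι) :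
    (unitElt i : Ext ι) = word [Sum.inl i, Sum.inr (LTree.leaf i)] := rfl

theorem bracket_word [Fintype ι] (T S : LTree ι) (h : Disjoint T.leaves S.leaves) (L M : List ι) :
    bracket (word (Sum.inr T :: L.map Sum.inl)) (word (Sum.inr S :: M.map Sum.inl)) =
        word (Sum.inr (T.graft S h) :: (L ++ M).map Sum.inl) ∨
      bracket (word (Sum.inr T :: L.map Sum.inl)) (word (Sum.inr S :: M.map Sum.inl)) =
        -word (Sum.inr (T.graft S h) :: (L ++ M).map Sum.inl) := by
  have d : ∀ (U V : LTree ι) (L : List ι), del (Sum.inr U) (word (Sum.inr V :: L.map Sum.inl)) =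
      if V = U then word (L.map Sum.inl) else 0 := by
    intro U V L
    rw [word_cons, del_gen_mul, del_word_of_notMem (by simp)]
    simp
  have e : bracket (word (Sum.inr T :: L.map Sum.inl)) (word (Sum.inr S :: M.map Sum.inl)) =
      gen (Sum.inr (T.graft S h)) * del (Sum.inr T) (inv (word (Sum.inr T :: L.map Sum.inl))) *
        word (M.map Sum.inl) := by
    simp only [bracket, LinearMap.sum_apply]
    rw [Finset.sum_eq_single T, Finset.sum_eq_single S]
    · rw [dif_pos h]
      simp [d]
    · intro U _ hU
      split_ifs
      · simp [d, Ne.symm hU]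
      · simp
    · simp
    · intro U _ hU
      refine Finset.sum_eq_zero fun V _ => ?_
      split_ifs
      · rcases inv_word (Sum.inr T :: L.map Sum.inl) with e | e <;> simp [d, Ne.symm hU, e]
      · simp
    · simp
  rw [e, List.map_append, word_cons (Sum.inr (T.graft S h)), word_append]
  rcases inv_word (Sum.inr T :: L.map Sum.inl) with e' | e' <;> simp [d, e', mul_assoc]

theorem exists_treeMonomial_aux [Fintype ι] {A : Finset ι} {N : Finset (Finset ι)}
    (h : IsBinaryTree A N) : ∃ (t : TreeMonomial A) (L : List ι), L.Nodup ∧ (∀ i, i ∈ L ↔ i ∈ A) ∧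
      ((t.eval : Ext ι) = word (Sum.inr ⟨A, N, h⟩ :: L.map Sum.inl) ∨
        (t.eval : Ext ι) = -word (Sum.inr ⟨A, N, h⟩ :: L.map Sum.inl)) := by
  induction h with
  | leaf i =>
    refine ⟨.leaf i, [i], by simp, by simp, ?_⟩
    rw [TreeMonomial.eval, coe_unitElt]
    exact word_perm (List.Perm.swap _ _ _)
  | @graft A B N M h hA hB ih1 ih2 =>
    obtain ⟨s, L, hL, hL', hs⟩ := ih1
    obtain ⟨t, L2, hM, hM', ht⟩ := ih2
    refine ⟨.node h s t, L ++ L2, hL.append hM ?_, ?_, ?_⟩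
    · intro i hi hi'
      exact Finset.disjoint_left.1 h ((hL' i).1 hi) ((hM' i).1 hi')
    · intro i
      rw [List.mem_append, hL', hM', Finset.mem_union]
    · have e : ((TreeMonomial.node h s t).eval : Ext ι) = bracket (s.eval : Ext ι) t.eval := rfl
      rw [e]
      have := bracket_word ⟨A, N, hA⟩ ⟨B, M, hB⟩ h L L2
      simp only [LTree.graft] at this
      rcases hs with hs | hs <;> rcases ht with ht | ht <;> rcases this with h' | h' <;>
        simp [hs, ht, h']

theorem exists_treeMonomial [Fintype ι] (T : LTree ι) :
    ∃ (t : TreeMonomial T.leaves) (L : List (ι ⊕ LTree ι)), L.Nodup ∧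
      (∀ g, g ∈ L ↔ g ∈ T.leaves.disjSum {T}) ∧ (t.eval : Ext ι) = word L := by
  obtain ⟨t, L, hL, hL', ht⟩ := exists_treeMonomial_aux T.isTree
  have nd : (Sum.inr T :: L.map Sum.inl : List (ι ⊕ LTree ι)).Nodup :=
    List.nodup_cons.2 ⟨by simp, hL.map Sum.inl_injective⟩
  have hm : ∀ g, g ∈ (Sum.inr T :: L.map Sum.inl : List (ι ⊕ LTree ι)) ↔
      g ∈ T.leaves.disjSum {T} := by
    rintro (i | U) <;> simp [hL']
  rcases ht with ht | ht
  · exact ⟨t, _, nd, hm, ht⟩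
  · obtain ⟨i, hi⟩ := T.leaves_nonempty
    rcases L with _ | ⟨j, L⟩
    · exact absurd ((hL' i).2 hi) (by simp)
    · have p : (Sum.inl j :: Sum.inr T :: L.map Sum.inl : List (ι ⊕ LTree ι)).Perm
          (Sum.inr T :: (j :: L).map Sum.inl) := List.Perm.swap _ _ _
      refine ⟨t, _, p.nodup_iff.2 nd, fun g => p.mem_iff.trans (hm g), ?_⟩
      rw [ht, List.map_cons, word_cons, word_cons, word_cons, word_cons, ← mul_assoc,
        gen_mul_gen, neg_mul, neg_neg, mul_assoc]

theorem exists_forestMonomial_aux [Fintype ι] (s : Finset (LTree ι)) :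
    (∀ T ∈ s, ∀ S ∈ s, T ≠ S → Disjoint T.leaves S.leaves) →
    ∃ (t : ForestMonomial (s.biUnion LTree.leaves)) (L : List (ι ⊕ LTree ι)), L.Nodup ∧
      (∀ g, g ∈ L ↔ g ∈ (s.biUnion LTree.leaves).disjSum s) ∧ (t.eval : Ext ι) = word L := by
  induction s using Finset.induction_on with
  | empty => exact fun _ => ⟨.nil, [], by simp, by simp, rfl⟩
  | insert T s hT ih =>
    intro h
    obtain ⟨t, L, hL, hL', ht⟩ := ih fun U hU V hV =>
      h U (Finset.mem_insert_of_mem hU) V (Finset.mem_insert_of_mem hV)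
    obtain ⟨u, M, hM, hM', hu⟩ := exists_treeMonomial T
    have hd : Disjoint T.leaves (s.biUnion LTree.leaves) := by
      rw [Finset.disjoint_biUnion_right]
      intro U hU
      exact h T (Finset.mem_insert_self _ _) U (Finset.mem_insert_of_mem hU)
        (fun e => hT (e ▸ hU))
    rw [Finset.biUnion_insert]
    refine ⟨.cons hd u t, M ++ L, hM.append hL ?_, ?_, ?_⟩
    · intro g hg hg'
      rw [hM'] at hg
      rw [hL'] at hg'
      rcases g with i | U
      · rw [Finset.inl_mem_disjSum] at hg hg'
        exact Finset.disjoint_left.1 hd hg hg'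
      · rw [Finset.inr_mem_disjSum] at hg hg'
        exact hT (Finset.mem_singleton.1 hg ▸ hg')
    · intro g
      rw [List.mem_append, hM', hL']
      rcases g with i | U
      · simp only [Finset.inl_mem_disjSum, Finset.mem_union]
      · simp only [Finset.inr_mem_disjSum, Finset.mem_singleton, Finset.mem_insert]
    · rw [word_append, ← hu, ← ht]
      rfl

/-- Every forest is, with a suitable orientation, the value of a monomial. -/
theorem exists_forestMonomial [Fintype ι] (F : Forest J) :
    ∃ p : ForestMonomial J × F.Orientation, p.1.eval = p.2.elt := by
  obtain ⟨s, hs, rfl⟩ := F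
  obtain ⟨t, L, hL, hL', ht⟩ := exists_forestMonomial_aux s hs
  exact ⟨⟨t, ⟨L, hL, hL'⟩⟩, Subtype.ext ht⟩

/-- A monomial whose value is the forest `F` with some orientation. -/
noncomputable def Forest.monomial [Fintype ι] (F : Forest J) : ForestMonomial J :=
  (exists_forestMonomial F).choose.1

/-- The orientation `o` of `F` such that the value of the monomial `F.monomial` is `o ⊗ F`. -/
noncomputable def Forest.orientation [Fintype ι] (F : Forest J) : F.Orientation :=
  (exists_forestMonomial F).choose.2

theorem Forest.eval_monomial [Fintype ι] (F : Forest J) :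
    F.monomial.eval = F.orientation.elt :=
  (exists_forestMonomial F).choose_spec

/-- The element of the dual space `Bess*(J)` that is indexed by the oriented forest `o ⊗ F`: its
value is `1` on `o ⊗ F`, hence `-1` on `F` with the opposite orientation, and `0` on `o' ⊗ F'`
if `F' ≠ F`. -/
noncomputable def Forest.Orientation.dual {F : Forest J} (o : F.Orientation) :
    Module.Dual ℚ (Bess J) :=
  coeff o.list ∘ₗ (Bess J).subtype

theorem Forest.Orientation.dual_elt_self {F : Forest J} (o : F.Orientation) :
    o.dual o.elt = 1 := by
  have key : ∀ L : List (ι ⊕ LTree ι), L.Nodup → coeff L (word L) = 1 := by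
    intro L
    induction L with
    | nil => intro _; simp [coeff, word]
    | cons g L ih =>
      intro h
      rw [List.nodup_cons] at h
      rw [coeff, LinearMap.comp_apply, word_cons, del_gen_mul, if_pos rfl,
        del_word_of_notMem h.1, mul_zero, sub_zero, ih h.2]
  exact key _ o.nodup

theorem Forest.Orientation.dual_elt_of_ne {F F' : Forest J} (o : F.Orientation)
    (o' : F'.Orientation) (h : F ≠ F') : o.dual o'.elt = 0 := by
  have key : ∀ L L' : List (ι ⊕ LTree ι), L'.Nodup → ¬ L.Perm L' → coeff L (word L') = 0 := by
    intro L
    induction L with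
    | nil =>
      intro L' _ hp
      rcases L' with _ | ⟨g, L'⟩
      · exact absurd (List.Perm.refl _) hp
      · simp [coeff, word_cons, gen, ExteriorAlgebra.algebraMapInv]
    | cons g L ih =>
      intro L' hn hp
      rw [coeff, LinearMap.comp_apply]
      by_cases hg : g ∈ L'
      · obtain ⟨a, b, rfl⟩ := List.append_of_mem hg
        have p : (a ++ g :: b).Perm (g :: (a ++ b)) := List.perm_middle
        have z := ih (a ++ b) (List.nodup_cons.1 (p.nodup_iff.1 hn)).2
          fun q => hp ((q.cons g).trans p.symm)
        rcases del_word_of_perm hn p with e | e <;> rw [e] <;> simp [z]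
      · rw [del_word_of_notMem hg, map_zero]
  refine key _ _ o'.nodup fun p => h ?_
  ext T
  have := ((o.mem_iff (Sum.inr T)).symm.trans p.mem_iff).trans (o'.mem_iff (Sum.inr T))
  simpa using this

/-- The coproduct `Δ : Bess(J) → Bess(J) ⊗ Bess(J)`, which is the morphism of operads from `Bess`
to `Bess ⊗ Bess` with `Δ(E) = E ⊗ E` and `Δ(Ω) = E ⊗ Ω + Ω ⊗ E`: for each forest `F` on `J` (with
one of its orientations, which form a basis of `Bess(J)`), written as a monomial in `E` and `Ω`,
its value is the same monomial in `Δ(E)` and `Δ(Ω)`. -/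
noncomputable def coproduct [Fintype ι] (J : Finset ι) :
    Bess J →ₗ[ℚ] Bess J ⊗[ℚ] Bess J :=
  ∑ F : Forest J, F.orientation.dual.smulRight F.monomial.delta

/-- The product `f × g` of the algebra `Bess*(J)`, i.e. the opposite of the dual product of the
coproduct: `(f × g)(x) = ∑ f(x') g(x'')` for `Δ(x) = ∑ x' ⊗ x''`, without a Koszul sign. -/
noncomputable def dualMul [Fintype ι] (f g : Module.Dual ℚ (Bess J)) : Module.Dual ℚ (Bess J) :=
  TensorProduct.dualDistrib ℚ (Bess J) (Bess J) (f ⊗ₜ g) ∘ₗ coproduct J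

/-- The forest `F` appears in the element `f` of `Bess*(J)`: the coefficient of `F`, with one of
its orientations, in the expansion of `f` in the dual basis is not zero. -/
def Forest.Appears (F : Forest J) (f : Module.Dual ℚ (Bess J)) : Prop :=
  ∃ o : F.Orientation, f o.elt ≠ 0

end Bess

end Bessel

/-!
Since `Δ(E) = E ⊗ E`, the pairing of `(o₁ ⊗ F₁) ⊗ (o₂ ⊗ F₂)` with `Δ` of a disjoint union is, up to
sign, the product of the pairings over the trees of that union, and it is zero unless `F₁` and `F₂`
split in the same way. So everything reduces to `Δ(T)` for a single tree `T` on `J`.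

* The coproduct preserves the number of inner vertices, so a nonzero pairing forces `F₁` and `F₂` to
  have `|J| - 1` inner vertices together. A forest with a nonempty support has fewer inner vertices
  than leaves in the support, so two nonempty disjoint supports are impossible.
* The forest without inner vertices is dual to a two-sided counit: it kills the values of `Ω` and is
  multiplicative for `E`. Hence, when one of the two supports is empty, the pairing sees `T` itself,
  and is nonzero exactly if the other forest is `T`.

Instead of the number of inner vertices, the proof counts exterior degrees: the algebra endomorphism
which multiplies all generators by `c` acts on an oriented forest by `c ^ (|J| + number of trees)`,
and at `c = -1` it is the Koszul parity.
-/

namespace Bessel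

section Trees

variable {ι : Type*} [DecidableEq ι]

namespace LTree

theorem leaves_mem_vertices (T : LTree ι) : T.leaves ∈ T.vertices := by
  obtain ⟨A, N, h⟩ := T
  cases h <;> simp

theorem subset_leaves_of_mem_vertices {T : LTree ι} {v : Finset ι} (hv : v ∈ T.vertices) :
    v ⊆ T.leaves := by
  obtain ⟨A, N, h⟩ := T
  dsimp only at hv ⊢
  induction h with
  | leaf i => simp_all
  | graft _ _ _ ihA ihB =>
    rcases Finset.mem_insert.1 hv with rfl | hv
    · exact subset_rfl
    · rcases Finset.mem_union.1 hv with hv | hv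
      · exact (ihA hv).trans Finset.subset_union_left
      · exact (ihB hv).trans Finset.subset_union_right

theorem leaf_injective : Function.Injective (leaf : ι → LTree ι) := fun _ _ h =>
  Finset.singleton_injective (congrArg leaves h)

theorem exists_eq_leaf {T : LTree ι} (h : T.leaves.card ≤ 1) : ∃ i, T = leaf i := by
  obtain ⟨A, N, hT⟩ := T
  cases hT with
  | leaf i => exact ⟨i, rfl⟩
  | @graft A B N M hAB hA hB =>
    have hA_pos : 0 < A.card := (leaves_nonempty ⟨A, N, hA⟩).card_pos
    have hB_pos : 0 < B.card := (leaves_nonempty ⟨B, M, hB⟩).card_pos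
    rw [Finset.card_union_of_disjoint hAB] at h
    omega

end LTree

namespace Forest

variable {J K : Finset ι}

theorem pairwiseDisjoint (F : Forest J) :
    (F.trees : Set (LTree ι)).PairwiseDisjoint LTree.leaves :=
  fun T hT S hS => F.disjoint T hT S hS

theorem eq_of_mem_leaves (F : Forest J) {T S : LTree ι} (hT : T ∈ F.trees) (hS : S ∈ F.trees)
    {i : ι} (hiT : i ∈ T.leaves) (hiS : i ∈ S.leaves) : T = S :=
  F.pairwiseDisjoint.elim_finset hT hS i hiT hiS

theorem exists_mem_leaves (F : Forest J) {i : ι} (hi : i ∈ J) :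
    ∃ T ∈ F.trees, i ∈ T.leaves := by
  rw [← F.cover] at hi
  exact Finset.mem_biUnion.1 hi

theorem card_trees_le (F : Forest J) : F.trees.card ≤ J.card := by
  conv_rhs => rw [← F.cover]
  exact Finset.card_le_card_biUnion F.pairwiseDisjoint fun T _ => T.leaves_nonempty

/-- The trees of `F` with at least one inner vertex, recognized by their having at least two
leaves. They determine the forest. -/
def nontrivialTrees (F : Forest J) : Finset (LTree ι) :=
  F.trees.filter fun T => 1 < T.leaves.card

theorem mem_nontrivialTrees {F : Forest J} {T : LTree ι} :
    T ∈ F.nontrivialTrees ↔ T ∈ F.trees ∧ 1 < T.leaves.card := Finset.mem_filter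

theorem nontrivialTrees_subset (F : Forest J) : F.nontrivialTrees ⊆ F.trees :=
  Finset.filter_subset _ _

theorem support_eq_biUnion (F : Forest J) :
    F.support = F.nontrivialTrees.biUnion LTree.leaves := by
  ext i
  simp only [support, Finset.mem_filter, Finset.mem_biUnion, mem_nontrivialTrees]
  constructor
  · rintro ⟨_, T, hT, v, hv, hi, hcard⟩
    have hvT := LTree.subset_leaves_of_mem_vertices hv
    exact ⟨T, ⟨hT, hcard.trans (Finset.card_le_card hvT)⟩, hvT hi⟩
  · rintro ⟨T, ⟨hT, hcard⟩, hi⟩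
    exact ⟨F.leaves_subset hT hi, T, hT, T.leaves, T.leaves_mem_vertices, hi, hcard⟩

theorem support_subset (F : Forest J) : F.support ⊆ J :=
  Finset.filter_subset _ _

theorem leaves_subset_support {F : Forest J} {T : LTree ι} (hT : T ∈ F.nontrivialTrees) :
    T.leaves ⊆ F.support := by
  rw [support_eq_biUnion]
  exact Finset.subset_biUnion_of_mem LTree.leaves hT

theorem on_support_of_subset {F G : Forest J} (h : G.nontrivialTrees ⊆ F.trees) :
    F.on G.support = G.nontrivialTrees := by
  ext T
  rw [on, Finset.mem_filter]
  refine ⟨fun ⟨hT, hsupp⟩ => ?_, fun hT => ⟨h hT, leaves_subset_support hT⟩⟩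
  obtain ⟨i, hi⟩ := T.leaves_nonempty
  have hi_supp := hsupp hi
  rw [support_eq_biUnion] at hi_supp
  obtain ⟨S, hS, hiS⟩ := Finset.mem_biUnion.1 hi_supp
  rwa [F.eq_of_mem_leaves hT (h hS) hi hiS]

theorem on_support (F : Forest J) : F.on F.support = F.nontrivialTrees :=
  on_support_of_subset F.nontrivialTrees_subset

theorem isUnionOf_iff {F F₁ F₂ : Forest J} :
    F.IsUnionOf F₁ F₂ ↔ F.nontrivialTrees = F₁.nontrivialTrees ∪ F₂.nontrivialTrees := by
  simp only [IsUnionOf, on_support]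
  constructor
  · rintro ⟨hsupp, hon₁, hon₂⟩
    have hsub : F₁.nontrivialTrees ∪ F₂.nontrivialTrees ⊆ F.trees := by
      rw [← hon₁, ← hon₂]
      exact Finset.union_subset (Finset.filter_subset _ _) (Finset.filter_subset _ _)
    refine subset_antisymm (fun T hT => ?_) fun T hT => mem_nontrivialTrees.2 ⟨hsub hT, ?_⟩
    · obtain ⟨i, hi⟩ := T.leaves_nonempty
      have hi_supp := leaves_subset_support hT hi
      rw [hsupp, support_eq_biUnion, support_eq_biUnion, ← Finset.union_biUnion] at hi_supp
      obtain ⟨S, hS, hiS⟩ := Finset.mem_biUnion.1 hi_supp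
      rwa [F.eq_of_mem_leaves (F.nontrivialTrees_subset hT) (hsub hS) hi hiS]
    · exact (Finset.mem_union.1 hT).elim (fun hT => (mem_nontrivialTrees.1 hT).2)
        fun hT => (mem_nontrivialTrees.1 hT).2
  · intro h
    have hsub : F₁.nontrivialTrees ∪ F₂.nontrivialTrees ⊆ F.trees :=
      h ▸ F.nontrivialTrees_subset
    refine ⟨?_, on_support_of_subset (Finset.union_subset_left hsub),
      on_support_of_subset (Finset.union_subset_right hsub)⟩
    simp only [support_eq_biUnion, h, Finset.union_biUnion]

theorem trees_eq_union (F : Forest J) :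
    F.trees = F.nontrivialTrees ∪ (J \ F.support).image LTree.leaf := by
  ext T
  simp only [Finset.mem_union, Finset.mem_image, Finset.mem_sdiff]
  constructor
  · intro hT
    rcases lt_or_ge 1 T.leaves.card with hcard | hcard
    · exact Or.inl (mem_nontrivialTrees.2 ⟨hT, hcard⟩)
    · obtain ⟨i, rfl⟩ := LTree.exists_eq_leaf hcard
      have hi : i ∈ (LTree.leaf i).leaves := Finset.mem_singleton_self i
      refine Or.inr ⟨i, ⟨F.leaves_subset hT hi, fun hi_supp => ?_⟩, rfl⟩
      rw [support_eq_biUnion] at hi_supp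
      obtain ⟨S, hS, hiS⟩ := Finset.mem_biUnion.1 hi_supp
      rw [mem_nontrivialTrees] at hS
      rw [F.eq_of_mem_leaves hT hS.1 hi hiS] at hcard
      exact hcard.not_gt hS.2
  · rintro (hT | ⟨i, ⟨hi, hi_supp⟩, rfl⟩)
    · exact F.nontrivialTrees_subset hT
    · obtain ⟨T, hT, hiT⟩ := F.exists_mem_leaves hi
      have hcard : T.leaves.card ≤ 1 := not_lt.1 fun hcard =>
        hi_supp (leaves_subset_support (mem_nontrivialTrees.2 ⟨hT, hcard⟩) hiT)
      obtain ⟨j, rfl⟩ := LTree.exists_eq_leaf hcard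
      rwa [Finset.mem_singleton.1 hiT]

theorem nontrivialTrees_injective : Function.Injective (nontrivialTrees (J := J)) := by
  intro F G h
  ext1
  rw [F.trees_eq_union, G.trees_eq_union, support_eq_biUnion, support_eq_biUnion, h]

theorem card_trees_add_card_support (F : Forest J) :
    F.trees.card + F.support.card = J.card + F.nontrivialTrees.card := by
  have hdisj : Disjoint F.nontrivialTrees ((J \ F.support).image LTree.leaf) := by
    rw [Finset.disjoint_left]
    rintro T hT hleaf
    obtain ⟨i, -, rfl⟩ := Finset.mem_image.1 hleaf
    simpa [LTree.leaf] using (mem_nontrivialTrees.1 hT).2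
  rw [trees_eq_union, Finset.card_union_of_disjoint hdisj,
    Finset.card_image_of_injective _ LTree.leaf_injective,
    ← Finset.card_sdiff_add_card_eq_card F.support_subset]
  ring

theorem card_lt_card_trees_add_card_support {F : Forest J} (h : F.support.Nonempty) :
    J.card < F.trees.card + F.support.card := by
  rw [support_eq_biUnion, Finset.biUnion_nonempty] at h
  obtain ⟨T, hT, -⟩ := h
  rw [card_trees_add_card_support]
  exact Nat.lt_add_of_pos_right (Finset.card_pos.2 ⟨T, hT⟩)

/-- The forest on `J` made of the trees in `B` and, for each of the remaining elements of `J`, of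
the tree with that single leaf. -/
def ofTrees (B : Finset (LTree ι)) (hB : (B : Set (LTree ι)).PairwiseDisjoint LTree.leaves)
    (hBJ : B.biUnion LTree.leaves ⊆ J) : Forest J where
  trees := B ∪ (J \ B.biUnion LTree.leaves).image LTree.leaf
  disjoint := by
    have hleaf : ∀ T ∈ B, ∀ i ∈ J \ B.biUnion LTree.leaves, Disjoint T.leaves {i} := by
      intro T hT i hi
      rw [Finset.disjoint_singleton_right]
      exact fun hiT => (Finset.mem_sdiff.1 hi).2 (Finset.mem_biUnion.2 ⟨T, hT, hiT⟩)
    intro T hT S hS hTS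
    rcases Finset.mem_union.1 hT with hT | hT <;> rcases Finset.mem_union.1 hS with hS | hS
    · exact hB hT hS hTS
    · obtain ⟨i, hi, rfl⟩ := Finset.mem_image.1 hS
      exact hleaf T hT i hi
    · obtain ⟨i, hi, rfl⟩ := Finset.mem_image.1 hT
      exact (hleaf S hS i hi).symm
    · obtain ⟨i, -, rfl⟩ := Finset.mem_image.1 hT
      obtain ⟨j, -, rfl⟩ := Finset.mem_image.1 hS
      exact Finset.disjoint_singleton.2 fun hij => hTS (congrArg LTree.leaf hij)
  cover := by
    simp only [Finset.union_biUnion, Finset.image_biUnion, LTree.leaf,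
      Finset.biUnion_singleton_eq_self, Finset.union_sdiff_of_subset hBJ]

theorem nontrivialTrees_ofTrees {B : Finset (LTree ι)}
    (hB : (B : Set (LTree ι)).PairwiseDisjoint LTree.leaves)
    (hBJ : B.biUnion LTree.leaves ⊆ J) :
    (ofTrees B hB hBJ).nontrivialTrees = B.filter fun T => 1 < T.leaves.card := by
  rw [nontrivialTrees, ofTrees, Finset.filter_union, Finset.union_eq_left]
  intro T hT
  obtain ⟨hT, hcard⟩ := Finset.mem_filter.1 hT
  obtain ⟨i, -, rfl⟩ := Finset.mem_image.1 hT
  simp [LTree.leaf] at hcard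

theorem existsUnique_isUnionOf {F₁ F₂ : Forest J} (h : Disjoint F₁.support F₂.support) :
    ∃! F : Forest J, F.IsUnionOf F₁ F₂ := by
  have hdisj : ((F₁.nontrivialTrees ∪ F₂.nontrivialTrees : Finset (LTree ι)) :
      Set (LTree ι)).PairwiseDisjoint LTree.leaves := by
    rw [Finset.coe_union, Set.pairwiseDisjoint_union]
    exact ⟨F₁.pairwiseDisjoint.subset F₁.nontrivialTrees_subset,
      F₂.pairwiseDisjoint.subset F₂.nontrivialTrees_subset,
      fun T hT S hS _ => h.mono (leaves_subset_support hT) (leaves_subset_support hS)⟩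
  have hsub : (F₁.nontrivialTrees ∪ F₂.nontrivialTrees).biUnion LTree.leaves ⊆ J := by
    rw [Finset.union_biUnion, ← support_eq_biUnion, ← support_eq_biUnion]
    exact Finset.union_subset F₁.support_subset F₂.support_subset
  have hcard : ∀ T ∈ F₁.nontrivialTrees ∪ F₂.nontrivialTrees, 1 < T.leaves.card := fun T hT =>
    (Finset.mem_union.1 hT).elim (fun hT => (mem_nontrivialTrees.1 hT).2)
      fun hT => (mem_nontrivialTrees.1 hT).2
  have hunion := (nontrivialTrees_ofTrees hdisj hsub).trans (Finset.filter_true_of_mem hcard)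
  exact ⟨ofTrees _ hdisj hsub, isUnionOf_iff.2 hunion,
    fun G hG => nontrivialTrees_injective ((isUnionOf_iff.1 hG).trans hunion.symm)⟩

theorem IsUnionOf.card_trees_add {F F₁ F₂ : Forest J} (hF : F.IsUnionOf F₁ F₂)
    (h : Disjoint F₁.support F₂.support) :
    F.trees.card + J.card = F₁.trees.card + F₂.trees.card := by
  have hdisj : Disjoint F₁.nontrivialTrees F₂.nontrivialTrees := by
    rw [Finset.disjoint_left]
    intro T hT₁ hT₂
    obtain ⟨i, hi⟩ := T.leaves_nonempty
    exact Finset.disjoint_left.1 h (leaves_subset_support hT₁ hi) (leaves_subset_support hT₂ hi)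
  have hcard := F.card_trees_add_card_support
  rw [isUnionOf_iff.1 hF, hF.1, Finset.card_union_of_disjoint h,
    Finset.card_union_of_disjoint hdisj] at hcard
  have := F₁.card_trees_add_card_support
  have := F₂.card_trees_add_card_support
  omega

theorem nontrivialTrees_eq_empty_iff {F : Forest J} : F.nontrivialTrees = ∅ ↔ F.support = ∅ := by
  rw [support_eq_biUnion, ← Finset.not_nonempty_iff_eq_empty,
    ← Finset.not_nonempty_iff_eq_empty (s := Finset.biUnion _ _), Finset.biUnion_nonempty]
  exact not_congr (exists_congr fun T => (and_iff_left T.leaves_nonempty).symm)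

theorem eq_of_support_eq_empty {F G : Forest J} (hF : F.support = ∅) (hG : G.support = ∅) :
    F = G :=
  nontrivialTrees_injective <|
    (nontrivialTrees_eq_empty_iff.2 hF).trans (nontrivialTrees_eq_empty_iff.2 hG).symm

theorem card_trees_of_support_eq_empty {F : Forest J} (hF : F.support = ∅) :
    F.trees.card = J.card := by
  simpa only [hF, nontrivialTrees_eq_empty_iff.2 hF, Finset.card_empty, add_zero] using
    F.card_trees_add_card_support

theorem isUnionOf_iff_eq_right {F F₁ F₂ : Forest J} (h : F₁.support = ∅) :
    F.IsUnionOf F₁ F₂ ↔ F = F₂ := by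
  rw [isUnionOf_iff, nontrivialTrees_eq_empty_iff.2 h, Finset.empty_union,
    nontrivialTrees_injective.eq_iff]

theorem isUnionOf_iff_eq_left {F F₁ F₂ : Forest J} (h : F₂.support = ∅) :
    F.IsUnionOf F₁ F₂ ↔ F = F₁ := by
  rw [isUnionOf_iff, nontrivialTrees_eq_empty_iff.2 h, Finset.union_empty,
    nontrivialTrees_injective.eq_iff]

theorem nontrivialTrees_union (h : Disjoint J K) (F : Forest J) (G : Forest K) :
    (F.union h G).nontrivialTrees = F.nontrivialTrees ∪ G.nontrivialTrees :=
  Finset.filter_union _ _ _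

theorem support_union (h : Disjoint J K) (F : Forest J) (G : Forest K) :
    (F.union h G).support = F.support ∪ G.support := by
  simp only [support_eq_biUnion, nontrivialTrees_union, Finset.union_biUnion]

theorem union_on_left (h : Disjoint J K) (F : Forest J) (G : Forest K) :
    (F.union h G).on J = F.trees := by
  ext T
  simp only [on, union, Finset.mem_filter, Finset.mem_union]
  refine ⟨fun ⟨hT, hTJ⟩ => hT.resolve_right fun hTG => ?_,
    fun hT => ⟨Or.inl hT, F.leaves_subset hT⟩⟩
  obtain ⟨i, hi⟩ := T.leaves_nonempty
  exact Finset.disjoint_left.1 h (hTJ hi) (G.leaves_subset hTG hi)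

theorem union_on_right (h : Disjoint J K) (F : Forest J) (G : Forest K) :
    (F.union h G).on K = G.trees := by
  rw [← union_on_left h.symm G F]
  simp only [on, union, Finset.union_comm]

theorem union_inj (h : Disjoint J K) {F F' : Forest J} {G G' : Forest K} :
    F.union h G = F'.union h G' ↔ F = F' ∧ G = G' := by
  refine ⟨fun e => ⟨?_, ?_⟩, fun ⟨eF, eG⟩ => by rw [eF, eG]⟩ <;> ext1
  · rw [← union_on_left h F G, e, union_on_left]
  · rw [← union_on_right h F G, e, union_on_right]

theorem exists_eq_union_iff (h : Disjoint J K) {F : Forest (J ∪ K)} :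
    (∃ (G : Forest J) (H : Forest K), F = G.union h H) ↔
      ∀ T ∈ F.nontrivialTrees, T.leaves ⊆ J ∨ T.leaves ⊆ K := by
  constructor
  · rintro ⟨G, H, rfl⟩ T hT
    rw [nontrivialTrees_union] at hT
    exact (Finset.mem_union.1 hT).imp
      (fun hT => G.leaves_subset (G.nontrivialTrees_subset hT))
      fun hT => H.leaves_subset (H.nontrivialTrees_subset hT)
  · intro hF
    have hdisj (s : Finset ι) : ((F.nontrivialTrees.filter fun T => T.leaves ⊆ s : Finset _) :
        Set (LTree ι)).PairwiseDisjoint LTree.leaves :=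
      F.pairwiseDisjoint.subset <| (Finset.filter_subset _ _).trans F.nontrivialTrees_subset
    have hsub (s : Finset ι) :
        (F.nontrivialTrees.filter fun T => T.leaves ⊆ s).biUnion LTree.leaves ⊆ s :=
      Finset.biUnion_subset.2 fun T hT => (Finset.mem_filter.1 hT).2
    refine ⟨ofTrees _ (hdisj J) (hsub J), ofTrees _ (hdisj K) (hsub K),
      nontrivialTrees_injective ?_⟩
    rw [nontrivialTrees_union, nontrivialTrees_ofTrees, nontrivialTrees_ofTrees,
      ← Finset.filter_union, ← Finset.filter_or, Finset.filter_true_of_mem hF,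
      Finset.filter_true_of_mem fun T hT => (mem_nontrivialTrees.1 hT).2]

theorem isUnionOf_union (h : Disjoint J K) {F F₁ F₂ : Forest J} {G G₁ G₂ : Forest K} :
    (F.union h G).IsUnionOf (F₁.union h G₁) (F₂.union h G₂) ↔
      F.IsUnionOf F₁ F₂ ∧ G.IsUnionOf G₁ G₂ := by
  have filter_left (A : Forest J) (B : Forest K) :
      ((A.union h B).nontrivialTrees.filter fun T => T.leaves ⊆ J) = A.nontrivialTrees := by
    rw [nontrivialTrees, Finset.filter_comm, ← on, union_on_left, nontrivialTrees]
  have filter_right (A : Forest J) (B : Forest K) :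
      ((A.union h B).nontrivialTrees.filter fun T => T.leaves ⊆ K) = B.nontrivialTrees := by
    rw [nontrivialTrees, Finset.filter_comm, ← on, union_on_right, nontrivialTrees]
  simp only [isUnionOf_iff]
  constructor
  · intro e
    constructor
    · simpa only [Finset.filter_union, filter_left] using
        congrArg (Finset.filter fun T => T.leaves ⊆ J) e
    · simpa only [Finset.filter_union, filter_right] using
        congrArg (Finset.filter fun T => T.leaves ⊆ K) e
  · rintro ⟨eF, eG⟩
    simp only [nontrivialTrees_union, eF, eG, Finset.union_union_union_comm]

theorem IsUnionOf.exists_eq_union (h : Disjoint J K) {F : Forest J} {G : Forest K}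
    {F₁ F₂ : Forest (J ∪ K)} (hu : (F.union h G).IsUnionOf F₁ F₂) :
    (∃ (F' : Forest J) (G' : Forest K), F₁ = F'.union h G') ∧
      ∃ (F' : Forest J) (G' : Forest K), F₂ = F'.union h G' := by
  have hsplit := (exists_eq_union_iff h).1 ⟨F, G, rfl⟩
  rw [isUnionOf_iff.1 hu] at hsplit
  exact ⟨(exists_eq_union_iff h).2 fun T hT => hsplit T (Finset.mem_union_left _ hT),
    (exists_eq_union_iff h).2 fun T hT => hsplit T (Finset.mem_union_right _ hT)⟩

end Forest

end Trees

section Scaling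

variable {ι : Type*} [DecidableEq ι] {J K : Finset ι}

/-- The multiplication by `c ^ n` in degree `n` of the exterior algebra. The grading involution is
`scale (-1)`. -/
noncomputable def scale (c : ℚ) : Ext ι →ₗ[ℚ] Ext ι :=
  (ExteriorAlgebra.map (c • LinearMap.id)).toLinearMap

theorem scale_one (c : ℚ) : scale c (1 : Ext ι) = 1 :=
  map_one (ExteriorAlgebra.map _)

theorem scale_mul (c : ℚ) (x y : Ext ι) : scale c (x * y) = scale c x * scale c y :=
  map_mul (ExteriorAlgebra.map _) x y

theorem scale_ι (c : ℚ) (m : (ι ⊕ LTree ι) →₀ ℚ) :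
    scale c (ExteriorAlgebra.ι ℚ m) = c • ExteriorAlgebra.ι ℚ m := by
  rw [scale, AlgHom.toLinearMap_apply, ExteriorAlgebra.map_apply_ι, LinearMap.smul_apply,
    LinearMap.id_apply, map_smul]

theorem scale_gen (c : ℚ) (g : ι ⊕ LTree ι) : scale c (gen g) = c • gen g :=
  scale_ι c _

theorem scale_word (c : ℚ) (L : List (ι ⊕ LTree ι)) :
    scale c (word L) = c ^ L.length • word L := by
  induction L with
  | nil => simp [word, scale_one]
  | cons g L ih =>
    rw [word_cons, scale_mul, scale_gen, ih, smul_mul_smul_comm, List.length_cons, pow_succ']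

theorem scale_scale (c d : ℚ) (x : Ext ι) : scale c (scale d x) = scale (c * d) x := by
  have : (ExteriorAlgebra.map (c • LinearMap.id)).comp (ExteriorAlgebra.map (d • LinearMap.id)) =
      (ExteriorAlgebra.map ((c * d) • LinearMap.id) : Ext ι →ₐ[ℚ] Ext ι) := by
    rw [ExteriorAlgebra.map_comp_map, LinearMap.smul_comp, LinearMap.id_comp, smul_smul]
  exact DFunLike.congr_fun this x

theorem scale_neg_one (x : Ext ι) : scale (-1) x = inv x := by
  have : (ExteriorAlgebra.map ((-1 : ℚ) • LinearMap.id) : Ext ι →ₐ[ℚ] Ext ι) =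
      CliffordAlgebra.involute := by
    ext m
    simp
  exact DFunLike.congr_fun this x

theorem inv_scale (c : ℚ) (x : Ext ι) : inv (scale c x) = scale c (inv x) := by
  rw [← scale_neg_one, ← scale_neg_one, scale_scale, scale_scale, mul_comm]

theorem del_ι_mul (g : ι ⊕ LTree ι) (m : (ι ⊕ LTree ι) →₀ ℚ) (x : Ext ι) :
    del g (ExteriorAlgebra.ι ℚ m * x) = m g • x - ExteriorAlgebra.ι ℚ m * del g x :=
  CliffordAlgebra.contractLeft_ι_mul (Q := (0 : QuadraticForm ℚ ((ι ⊕ LTree ι) →₀ ℚ)))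
    (Finsupp.lapply g) m x

theorem del_scale (g : ι ⊕ LTree ι) (c : ℚ) (x : Ext ι) :
    del g (scale c x) = c • scale c (del g x) := by
  induction x using CliffordAlgebra.left_induction with
  | algebraMap r => simp [del, scale]
  | add x y hx hy => simp only [map_add, hx, hy, smul_add]
  | ι_mul x m hx =>
    suffices del g (scale c (ExteriorAlgebra.ι ℚ m * x)) =
      c • scale c (del g (ExteriorAlgebra.ι ℚ m * x)) from this
    simp only [scale_mul, scale_ι, smul_mul_assoc, map_smul, del_ι_mul, hx, map_sub, mul_smul_comm]

theorem bracket_scale [Fintype ι] (c : ℚ) (x y : Ext ι) :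
    bracket (scale c x) (scale c y) = c • scale c (bracket x y) := by
  simp only [bracket, LinearMap.sum_apply, map_sum, Finset.smul_sum]
  refine Finset.sum_congr rfl fun T _ => Finset.sum_congr rfl fun S _ => ?_
  split_ifs with h
  · simp only [LinearMap.compl₁₂_apply, LinearMap.mul_apply', LinearMap.comp_apply,
      LinearMap.mulLeft_apply, inv_scale, del_scale, scale_mul, scale_gen, smul_mul_assoc,
      mul_smul_comm]
  · simp

theorem scale_mem (c : ℚ) {x : Ext ι} (hx : x ∈ Bess J) : scale c x ∈ Bess J := by
  have : Bess J ≤ (Bess J).comap (scale c) := by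
    conv_lhs => rw [Bess]
    rw [Submodule.span_le]
    rintro _ ⟨F, o, rfl⟩
    rw [SetLike.mem_coe, Submodule.mem_comap, scale_word]
    exact Submodule.smul_mem _ _ o.elt.2
  exact this hx

/-- The multiplication by `c ^ n` in degree `n` of the exterior algebra, restricted to `Bess(J)`. -/
noncomputable def rescale (c : ℚ) (J : Finset ι) : Bess J →ₗ[ℚ] Bess J :=
  (scale c).restrict fun _ hx => scale_mem c hx

theorem parity_eq_rescale (J : Finset ι) : parity J = rescale (-1) J :=
  LinearMap.ext fun x => Subtype.ext (scale_neg_one (x : Ext ι)).symm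

theorem parity_rescale (c : ℚ) (x : Bess J) : parity J (rescale c J x) = rescale c J (parity J x) :=
  Subtype.ext (inv_scale c (x : Ext ι))

theorem Forest.Orientation.length_list {F : Forest J} (o : F.Orientation) :
    o.list.length = J.card + F.trees.card := by
  rw [← List.toFinset_card_of_nodup o.nodup, ← Finset.card_disjSum]
  congr 1
  ext g
  rw [List.mem_toFinset, o.mem_iff]

theorem rescale_elt (c : ℚ) {F : Forest J} (o : F.Orientation) :
    rescale c J o.elt = c ^ (J.card + F.trees.card) • o.elt :=
  Subtype.ext <| (scale_word c o.list).trans (by rw [o.length_list]; rfl)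

theorem opE_rescale (c : ℚ) (h : Disjoint J K) (x : Bess J) (y : Bess K) :
    opE h (rescale c J x ⊗ₜ rescale c K y) = rescale c (J ∪ K) (opE h (x ⊗ₜ y)) :=
  Subtype.ext (scale_mul c (x : Ext ι) y).symm

theorem opΩ_rescale [Fintype ι] (c : ℚ) (h : Disjoint J K) (x : Bess J) (y : Bess K) :
    opΩ h (rescale c J x ⊗ₜ rescale c K y) = c • rescale c (J ∪ K) (opΩ h (x ⊗ₜ y)) :=
  Subtype.ext (bracket_scale c (x : Ext ι) y)

/-- The four terms encode the Koszul sign `(-1) ^ (|x''| |y'|)`, see `koszul_sign`. -/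
theorem tensorOp_tmul (P Q : Bess J ⊗[ℚ] Bess K →ₗ[ℚ] Bess (J ∪ K)) (x' x'' : Bess J)
    (y' y'' : Bess K) :
    tensorOp P Q ((x' ⊗ₜ x'') ⊗ₜ (y' ⊗ₜ y'')) = (1 / 2 : ℚ) •
      (P (x' ⊗ₜ y') ⊗ₜ Q (x'' ⊗ₜ y'') + P (x' ⊗ₜ parity K y') ⊗ₜ Q (x'' ⊗ₜ y'')
        + P (x' ⊗ₜ y') ⊗ₜ Q (parity J x'' ⊗ₜ y'')
        - P (x' ⊗ₜ parity K y') ⊗ₜ Q (parity J x'' ⊗ₜ y'')) := by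
  have hneg : -parity J = (-1 : ℚ) • parity J := by module
  simp only [tensorOp, braid, hneg, LinearMap.comp_apply, LinearEquiv.coe_coe,
    TensorProduct.tensorTensorTensorAssoc_tmul, TensorProduct.map_tmul, LinearMap.id_apply,
    TensorProduct.comm_tmul, LinearMap.smul_apply, LinearMap.add_apply, TensorProduct.tmul_smul,
    ← TensorProduct.smul_tmul', TensorProduct.tmul_add, TensorProduct.add_tmul, map_smul, map_add,
    TensorProduct.tensorTensorTensorAssoc_symm_tmul]
  module

theorem koszul_sign (m n : ℕ) :
    (1 / 2 : ℚ) * (1 + (-1) ^ n + (-1) ^ m - (-1) ^ m * (-1) ^ n) = (-1) ^ (m * n) := by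
  rw [pow_mul]
  rcases neg_one_pow_eq_or ℚ m with hm | hm <;> rcases neg_one_pow_eq_or ℚ n with hn | hn <;>
    rw [hm] <;> norm_num [hn]

theorem tensorOp_rescale {P Q : Bess J ⊗[ℚ] Bess K →ₗ[ℚ] Bess (J ∪ K)} {a b c : ℚ}
    (hP : ∀ x y, P (rescale c J x ⊗ₜ rescale c K y) = a • rescale c (J ∪ K) (P (x ⊗ₜ y)))
    (hQ : ∀ x y, Q (rescale c J x ⊗ₜ rescale c K y) = b • rescale c (J ∪ K) (Q (x ⊗ₜ y)))
    (z : Bess J ⊗[ℚ] Bess J) (w : Bess K ⊗[ℚ] Bess K) :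
    tensorOp P Q (TensorProduct.map (rescale c J) (rescale c J) z ⊗ₜ
        TensorProduct.map (rescale c K) (rescale c K) w) =
      (a * b) • TensorProduct.map (rescale c (J ∪ K)) (rescale c (J ∪ K))
        (tensorOp P Q (z ⊗ₜ w)) := by
  suffices tensorOp P Q ∘ₗ TensorProduct.map (TensorProduct.map (rescale c J) (rescale c J))
        (TensorProduct.map (rescale c K) (rescale c K)) =
      (a * b) • TensorProduct.map (rescale c (J ∪ K)) (rescale c (J ∪ K)) ∘ₗ tensorOp P Q from
    LinearMap.congr_fun this (z ⊗ₜ w)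
  refine TensorProduct.ext_fourfold' fun x' x'' y' y'' => ?_
  simp only [LinearMap.comp_apply, LinearMap.smul_apply, TensorProduct.map_tmul, tensorOp_tmul,
    parity_rescale, hP, hQ, map_smul, map_add, map_sub, TensorProduct.smul_tmul_smul]
  module

theorem deltaΩ_rescale [Fintype ι] (c : ℚ) (h : Disjoint J K) (z : Bess J ⊗[ℚ] Bess J)
    (w : Bess K ⊗[ℚ] Bess K) :
    deltaΩ h (TensorProduct.map (rescale c J) (rescale c J) z ⊗ₜ
        TensorProduct.map (rescale c K) (rescale c K) w) =
      c • TensorProduct.map (rescale c (J ∪ K)) (rescale c (J ∪ K)) (deltaΩ h (z ⊗ₜ w)) := by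
  rw [deltaΩ, LinearMap.add_apply, LinearMap.add_apply,
    tensorOp_rescale (a := 1) (b := c) _ (opΩ_rescale c h),
    tensorOp_rescale (a := c) (b := 1) (opΩ_rescale c h), one_mul, mul_one, map_add, smul_add]
  · exact fun x y => (opE_rescale c h x y).trans (one_smul _ _).symm
  · intro x y
    rw [one_smul]
    simp only [LinearMap.comp_apply, TensorProduct.map_tmul, parity_rescale, opE_rescale]

end Scaling

section Slices

variable {R M N : Type*} [CommSemiring R] [AddCommMonoid M] [AddCommMonoid N] [Module R M]
  [Module R N]

/-- The contraction `x ⊗ y ↦ f x • y` of the left factor of a tensor product. -/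
noncomputable def sliceLeft (f : Module.Dual R M) : M ⊗[R] N →ₗ[R] N :=
  (TensorProduct.lid R N).toLinearMap ∘ₗ f.rTensor N

/-- The contraction `x ⊗ y ↦ g y • x` of the right factor of a tensor product. -/
noncomputable def sliceRight (g : Module.Dual R N) : M ⊗[R] N →ₗ[R] M :=
  (TensorProduct.rid R M).toLinearMap ∘ₗ g.lTensor M

theorem sliceLeft_tmul (f : Module.Dual R M) (x : M) (y : N) :
    sliceLeft f (x ⊗ₜ y) = f x • y := by
  simp [sliceLeft]

theorem sliceRight_tmul (g : Module.Dual R N) (x : M) (y : N) :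
    sliceRight g (x ⊗ₜ y) = g y • x := by
  simp [sliceRight]

theorem dualDistrib_eq_sliceLeft (f : Module.Dual R M) (g : Module.Dual R N) (z : M ⊗[R] N) :
    TensorProduct.dualDistrib R M N (f ⊗ₜ g) z = g (sliceLeft f z) := by
  induction z with
  | zero => simp only [map_zero]
  | add z w hz hw => simp only [map_add, hz, hw]
  | tmul x y => simp [sliceLeft_tmul]

theorem dualDistrib_eq_sliceRight (f : Module.Dual R M) (g : Module.Dual R N) (z : M ⊗[R] N) :
    TensorProduct.dualDistrib R M N (f ⊗ₜ g) z = f (sliceRight g z) := by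
  induction z with
  | zero => simp only [map_zero]
  | add z w hz hw => simp only [map_add, hz, hw]
  | tmul x y => simp [sliceRight_tmul, mul_comm]

theorem dualDistrib_map {M' N' : Type*} [AddCommMonoid M'] [AddCommMonoid N'] [Module R M']
    [Module R N'] (f : Module.Dual R M') (g : Module.Dual R N') (P : M →ₗ[R] M')
    (Q : N →ₗ[R] N') (z : M ⊗[R] N) :
    TensorProduct.dualDistrib R M' N' (f ⊗ₜ g) (TensorProduct.map P Q z) =
      TensorProduct.dualDistrib R M N ((f ∘ₗ P) ⊗ₜ (g ∘ₗ Q)) z := by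
  induction z with
  | zero => simp only [map_zero]
  | add z w hz hw => simp only [map_add, hz, hw]
  | tmul x y => simp

end Slices

section Duality

variable {ι : Type*} [DecidableEq ι] {J K : Finset ι}

namespace Forest

instance (F : Forest J) : Nonempty F.Orientation :=
  ⟨⟨(J.disjSum F.trees).toList, Finset.nodup_toList _, fun _ => Finset.mem_toList⟩⟩

namespace Orientation

theorem elt_eq_or_eq_neg {F : Forest J} (o p : F.Orientation) :
    o.elt = p.elt ∨ o.elt = -p.elt := by
  have hperm : o.list.Perm p.list := (List.perm_ext_iff_of_nodup o.nodup p.nodup).2 fun g =>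
    (o.mem_iff g).trans (p.mem_iff g).symm
  exact (word_perm hperm).imp Subtype.ext Subtype.ext

/-- The exterior product of orientations of two forests, as an orientation of their disjoint
union. -/
def union (h : Disjoint J K) {F : Forest J} {G : Forest K} (o : F.Orientation)
    (p : G.Orientation) : (F.union h G).Orientation where
  list := o.list ++ p.list
  nodup := by
    refine List.Nodup.append o.nodup p.nodup fun g hgo hgp => ?_
    rw [o.mem_iff] at hgo
    rw [p.mem_iff] at hgp
    rcases g with i | T
    · rw [Finset.inl_mem_disjSum] at hgo hgp
      exact Finset.disjoint_left.1 h hgo hgp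
    · rw [Finset.inr_mem_disjSum] at hgo hgp
      exact Finset.disjoint_left.1 (trees_disjoint h F G) hgo hgp
  mem_iff g := by
    rw [List.mem_append, o.mem_iff, p.mem_iff]
    rcases g with i | T <;> simp [Forest.union]

theorem opE_elt (h : Disjoint J K) {F : Forest J} {G : Forest K} (o : F.Orientation)
    (p : G.Orientation) : opE h (o.elt ⊗ₜ p.elt) = (o.union h p).elt :=
  Subtype.ext (word_append o.list p.list).symm

theorem elt_eq_smul {F : Forest J} (o p : F.Orientation) : p.elt = o.dual p.elt • o.elt := by
  rcases p.elt_eq_or_eq_neg o with e | e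
  · rw [e, dual_elt_self, one_smul]
  · rw [e, map_neg, dual_elt_self]
    exact (neg_one_smul ℚ _).symm

theorem dual_elt_ne_zero_iff {F G : Forest J} (o : F.Orientation) (p : G.Orientation) :
    o.dual p.elt ≠ 0 ↔ F = G := by
  refine ⟨not_imp_comm.1 (o.dual_elt_of_ne p), ?_⟩
  rintro rfl
  rcases p.elt_eq_or_eq_neg o with e | e <;> simp [e, o.dual_elt_self]

end Orientation

end Forest

theorem Bess.hom_ext {M : Type*} [AddCommMonoid M] [Module ℚ M] {f g : Bess J →ₗ[ℚ] M}
    (h : ∀ (F : Forest J) (o : F.Orientation), f o.elt = g o.elt) : f = g := by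
  refine LinearMap.ext_on (Submodule.span_span_coe_preimage (R := ℚ)
    (s := {x : Ext ι | ∃ (F : Forest J) (o : F.Orientation), word o.list = x})) ?_
  rintro ⟨_, _⟩ ⟨F, o, rfl⟩
  exact h F o

theorem Bess.tensor_hom_ext {M : Type*} [AddCommMonoid M] [Module ℚ M]
    {f g : Bess J ⊗[ℚ] Bess K →ₗ[ℚ] M}
    (h : ∀ (F : Forest J) (o : F.Orientation) (G : Forest K) (p : G.Orientation),
      f (o.elt ⊗ₜ p.elt) = g (o.elt ⊗ₜ p.elt)) : f = g :=
  TensorProduct.ext <| Bess.hom_ext fun F o => Bess.hom_ext fun G p => h F o G p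

namespace Forest.Orientation

theorem dual_eq_smul {F : Forest J} (o p : F.Orientation) : p.dual = p.dual o.elt • o.dual := by
  refine Bess.hom_ext fun G q => ?_
  by_cases hG : F = G
  · subst hG
    rw [o.elt_eq_smul q, map_smul, LinearMap.smul_apply, map_smul, dual_elt_self]
    simp only [smul_eq_mul, one_mul, mul_comm]
  · rw [p.dual_elt_of_ne q hG, LinearMap.smul_apply, o.dual_elt_of_ne q hG, smul_zero]

theorem dual_rescale (c : ℚ) {F : Forest J} (o : F.Orientation) (x : Bess J) :
    o.dual (rescale c J x) = c ^ (J.card + F.trees.card) * o.dual x := by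
  suffices o.dual ∘ₗ rescale c J = c ^ (J.card + F.trees.card) • o.dual from
    LinearMap.congr_fun this x
  refine Bess.hom_ext fun G p => ?_
  by_cases hG : F = G
  · simp [rescale_elt, hG]
  · simp [rescale_elt, o.dual_elt_of_ne p hG]

theorem dual_parity {F : Forest J} (o : F.Orientation) (x : Bess J) :
    o.dual (parity J x) = (-1) ^ (J.card + F.trees.card) * o.dual x := by
  rw [parity_eq_rescale, dual_rescale]

theorem dual_opE (h : Disjoint J K) {F : Forest J} {G : Forest K} (o : F.Orientation)
    (p : G.Orientation) (x : Bess J) (y : Bess K) :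
    (o.union h p).dual (opE h (x ⊗ₜ y)) = o.dual x * p.dual y := by
  suffices (o.union h p).dual ∘ₗ opE h =
      TensorProduct.dualDistrib ℚ (Bess J) (Bess K) (o.dual ⊗ₜ p.dual) from
    (LinearMap.congr_fun this (x ⊗ₜ y)).trans (TensorProduct.dualDistrib_apply _ _ _ _)
  refine Bess.tensor_hom_ext fun F' o' G' p' => ?_
  rw [LinearMap.comp_apply, TensorProduct.dualDistrib_apply]
  by_cases e : F = F' ∧ G = G'
  · obtain ⟨rfl, rfl⟩ := e
    conv_lhs => rw [o.elt_eq_smul o', p.elt_eq_smul p', TensorProduct.smul_tmul_smul, map_smul,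
      map_smul, opE_elt, dual_elt_self, smul_eq_mul, mul_one]
  · rw [opE_elt, dual_elt_of_ne _ _ (mt (union_inj h).1 e)]
    rcases not_and_or.1 e with e | e
    · rw [o.dual_elt_of_ne o' e, zero_mul]
    · rw [p.dual_elt_of_ne p' e, mul_zero]

theorem dual_comp_opE_eq_zero (h : Disjoint J K) {F : Forest (J ∪ K)} (o : F.Orientation)
    (hF : ¬∃ (G : Forest J) (H : Forest K), F = G.union h H) : o.dual ∘ₗ opE h = 0 :=
  Bess.tensor_hom_ext fun G p H q => by
    rw [LinearMap.comp_apply, opE_elt, o.dual_elt_of_ne _ fun e => hF ⟨G, H, e⟩,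
      LinearMap.zero_apply]

theorem dualDistrib_deltaE (h : Disjoint J K) {F₁ F₂ : Forest J} {G₁ G₂ : Forest K}
    (o₁ : F₁.Orientation) (o₂ : F₂.Orientation) (p₁ : G₁.Orientation) (p₂ : G₂.Orientation)
    (z : Bess J ⊗[ℚ] Bess J) (w : Bess K ⊗[ℚ] Bess K) :
    TensorProduct.dualDistrib ℚ (Bess (J ∪ K)) (Bess (J ∪ K))
        ((o₁.union h p₁).dual ⊗ₜ (o₂.union h p₂).dual) (deltaE h (z ⊗ₜ w)) =
      (-1) ^ ((J.card + F₂.trees.card) * (K.card + G₁.trees.card)) *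
        (TensorProduct.dualDistrib ℚ (Bess J) (Bess J) (o₁.dual ⊗ₜ o₂.dual) z *
          TensorProduct.dualDistrib ℚ (Bess K) (Bess K) (p₁.dual ⊗ₜ p₂.dual) w) := by
  set ε : ℚ := (-1) ^ ((J.card + F₂.trees.card) * (K.card + G₁.trees.card)) with hε
  suffices TensorProduct.dualDistrib ℚ (Bess (J ∪ K)) (Bess (J ∪ K))
        ((o₁.union h p₁).dual ⊗ₜ (o₂.union h p₂).dual) ∘ₗ deltaE h =
      ε • TensorProduct.dualDistrib ℚ (Bess J ⊗[ℚ] Bess J) (Bess K ⊗[ℚ] Bess K)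
        (TensorProduct.dualDistrib ℚ (Bess J) (Bess J) (o₁.dual ⊗ₜ o₂.dual) ⊗ₜ
          TensorProduct.dualDistrib ℚ (Bess K) (Bess K) (p₁.dual ⊗ₜ p₂.dual)) from
    LinearMap.congr_fun this (z ⊗ₜ w)
  refine TensorProduct.ext_fourfold' fun x' x'' y' y'' => ?_
  simp only [deltaE, LinearMap.comp_apply, tensorOp_tmul, map_smul, map_add, map_sub,
    LinearMap.smul_apply, TensorProduct.dualDistrib_apply, dual_opE, dual_parity, smul_eq_mul]
  rw [hε, ← koszul_sign]
  ring

theorem dualDistrib_deltaE_eq_zero (h : Disjoint J K) {f g : Module.Dual ℚ (Bess (J ∪ K))}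
    (hfg : f ∘ₗ opE h = 0 ∨ g ∘ₗ opE h = 0)
    (z : (Bess J ⊗[ℚ] Bess J) ⊗[ℚ] (Bess K ⊗[ℚ] Bess K)) :
    TensorProduct.dualDistrib ℚ (Bess (J ∪ K)) (Bess (J ∪ K)) (f ⊗ₜ g) (deltaE h z) = 0 := by
  rw [deltaE, tensorOp, LinearMap.comp_apply, dualDistrib_map]
  rcases hfg with e | e <;>
    rw [e] <;> simp only [TensorProduct.zero_tmul, TensorProduct.tmul_zero, map_zero,
      LinearMap.zero_apply]

theorem card_trees_of_dual_opΩ_ne_zero [Fintype ι] (h : Disjoint J K) {F : Forest (J ∪ K)}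
    {G : Forest J} {H : Forest K} {o : F.Orientation} {p : G.Orientation} {q : H.Orientation}
    (hne : o.dual (opΩ h (p.elt ⊗ₜ q.elt)) ≠ 0) :
    G.trees.card + H.trees.card = F.trees.card + 1 := by
  have hscale := congrArg o.dual (opΩ_rescale 2 h p.elt q.elt)
  simp only [rescale_elt, TensorProduct.smul_tmul_smul, map_smul, dual_rescale, smul_eq_mul,
    ← mul_assoc, ← pow_add, ← pow_succ'] at hscale
  have hdeg := pow_right_injective₀ (two_pos (α := ℚ)) (by norm_num)
    (mul_right_cancel₀ hne hscale)
  rw [Finset.card_union_of_disjoint h] at hdeg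
  omega

theorem dual_comp_opΩ_eq_zero [Fintype ι] (h : Disjoint J K) {F : Forest (J ∪ K)}
    (hF : F.support = ∅) (o : F.Orientation) : o.dual ∘ₗ opΩ h = 0 := by
  refine Bess.tensor_hom_ext fun G p H q => not_not.1 fun hne => ?_
  have hcard := card_trees_of_dual_opΩ_ne_zero h hne
  rw [card_trees_of_support_eq_empty hF, Finset.card_union_of_disjoint h] at hcard
  have := G.card_trees_le
  have := H.card_trees_le
  omega

theorem dual_parity_of_support_eq_empty {F : Forest J} (hF : F.support = ∅) (o : F.Orientation)
    (x : Bess J) : o.dual (parity J x) = o.dual x := by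
  rw [dual_parity, card_trees_of_support_eq_empty hF, Even.neg_one_pow ⟨_, rfl⟩, one_mul]

variable [Fintype ι] (h : Disjoint J K) {F : Forest J} {G : Forest K} (hF : F.support = ∅)
  (hG : G.support = ∅) (o : F.Orientation) (p : G.Orientation)
include hF hG

theorem sliceRight_deltaΩ (z : Bess J ⊗[ℚ] Bess J) (w : Bess K ⊗[ℚ] Bess K) :
    sliceRight (o.union h p).dual (deltaΩ h (z ⊗ₜ w)) =
      opΩ h (sliceRight o.dual z ⊗ₜ sliceRight p.dual w) := by
  have hΩ := LinearMap.congr_fun <| dual_comp_opΩ_eq_zero h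
    (by rw [support_union, hF, hG, Finset.union_empty]) (o.union h p)
  suffices sliceRight (o.union h p).dual ∘ₗ deltaΩ h =
      opΩ h ∘ₗ TensorProduct.map (sliceRight o.dual) (sliceRight p.dual) from
    LinearMap.congr_fun this (z ⊗ₜ w)
  refine TensorProduct.ext_fourfold' fun x' x'' y' y'' => ?_
  simp only [LinearMap.comp_apply, LinearMap.zero_apply] at hΩ
  simp only [deltaΩ, LinearMap.comp_apply, LinearMap.add_apply, tensorOp_tmul, map_smul, map_add,
    map_sub, sliceRight_tmul, TensorProduct.map_tmul, hΩ, dual_opE,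
    dual_parity_of_support_eq_empty hF, TensorProduct.smul_tmul_smul]
  module

theorem sliceLeft_deltaΩ (z : Bess J ⊗[ℚ] Bess J) (w : Bess K ⊗[ℚ] Bess K) :
    sliceLeft (o.union h p).dual (deltaΩ h (z ⊗ₜ w)) =
      opΩ h (sliceLeft o.dual z ⊗ₜ sliceLeft p.dual w) := by
  have hΩ := LinearMap.congr_fun <| dual_comp_opΩ_eq_zero h
    (by rw [support_union, hF, hG, Finset.union_empty]) (o.union h p)
  suffices sliceLeft (o.union h p).dual ∘ₗ deltaΩ h =
      opΩ h ∘ₗ TensorProduct.map (sliceLeft o.dual) (sliceLeft p.dual) from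
    LinearMap.congr_fun this (z ⊗ₜ w)
  refine TensorProduct.ext_fourfold' fun x' x'' y' y'' => ?_
  simp only [LinearMap.comp_apply, LinearMap.zero_apply] at hΩ
  simp only [deltaΩ, LinearMap.comp_apply, LinearMap.add_apply, tensorOp_tmul, map_smul, map_add,
    map_sub, sliceLeft_tmul, TensorProduct.map_tmul, hΩ, dual_opE,
    dual_parity_of_support_eq_empty hF, dual_parity_of_support_eq_empty hG,
    TensorProduct.smul_tmul_smul]
  module

end Forest.Orientation

end Duality

section Coefficients

variable {ι : Type*} [DecidableEq ι] {J K : Finset ι}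

namespace TreeMonomial

/-- The vertices of the binary tree that a monomial in `Ω` describes, each given by the leaves above
it. -/
def vertices : {J : Finset ι} → TreeMonomial J → Finset (Finset ι)
  | _, .leaf i => {{i}}
  | _, .node (J := J) (K := K) _ s t => insert (J ∪ K) (s.vertices ∪ t.vertices)

theorem isBinaryTree (t : TreeMonomial J) : IsBinaryTree J t.vertices := by
  induction t with
  | leaf i => exact .leaf i
  | node h s t hs ht => exact .graft h hs ht

/-- The binary tree that a monomial in `Ω` describes. -/
def tree (t : TreeMonomial J) : LTree ι :=
  ⟨J, t.vertices, t.isBinaryTree⟩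

/-- The forest whose only tree is the one that a monomial in `Ω` describes. -/
def forest (t : TreeMonomial J) : Forest J :=
  t.tree.toForest

/-- The orientation `T ∧ i₁ ∧ ⋯ ∧ iₙ` of the forest with the single tree `T`, where `i₁, …, iₙ` are
the leaves of `T` in some order. -/
noncomputable def orientation (t : TreeMonomial J) : t.forest.Orientation where
  list := Sum.inr t.tree :: J.toList.map Sum.inl
  nodup := List.nodup_cons.2 ⟨by simp, (Finset.nodup_toList _).map Sum.inl_injective⟩
  mem_iff := by rintro (i | S) <;> simp [forest, LTree.toForest]

theorem exists_unitElt_eq_elt (i : ι) :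
    ∃ o : (TreeMonomial.leaf i).forest.Orientation, unitElt i = o.elt :=
  ⟨_, rfl⟩

end TreeMonomial

/-- The forest that a monomial in `E` and `Ω` describes. -/
def ForestMonomial.forest : {J : Finset ι} → ForestMonomial J → Forest J
  | _, .nil => ⟨∅, by simp, by simp⟩
  | _, .cons h s t => s.forest.union h t.forest

variable [Fintype ι]

namespace TreeMonomial

theorem opΩ_orientation_elt (h : Disjoint J K) (s : TreeMonomial J) (t : TreeMonomial K) :
    ∃ c : ℚ, c ≠ 0 ∧
      opΩ h (s.orientation.elt ⊗ₜ t.orientation.elt) = c • (node h s t).orientation.elt := by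
  have hperm : (J.toList ++ K.toList).Perm (J ∪ K).toList := by
    refine (List.perm_ext_iff_of_nodup ?_ (Finset.nodup_toList _)).2 fun i => by simp
    exact (Finset.nodup_toList _).append (Finset.nodup_toList _) fun i hJ hK =>
      Finset.disjoint_left.1 h (Finset.mem_toList.1 hJ) (Finset.mem_toList.1 hK)
  have sign {x y : Ext ι} (hxy : x = y ∨ x = -y) : ∃ c : ℚ, c ≠ 0 ∧ x = c • y :=
    hxy.elim (fun e => ⟨1, one_ne_zero, by rw [e, one_smul]⟩)
      fun e => ⟨-1, by norm_num, by rw [e, neg_one_smul]⟩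
  obtain ⟨c, hc, ec⟩ := sign (bracket_word s.tree t.tree h J.toList K.toList)
  obtain ⟨d, hd, ed⟩ := sign (word_perm ((hperm.map Sum.inl).cons (Sum.inr (node h s t).tree)))
  exact ⟨c * d, mul_ne_zero hc hd,
    Subtype.ext (ec.trans ((congrArg (c • ·) ed).trans (smul_smul c d _)))⟩

theorem exists_eval_eq_smul (t : TreeMonomial J) :
    ∃ c : ℚ, c ≠ 0 ∧ t.eval = c • t.orientation.elt := by
  induction t with
  | leaf i =>
    obtain ⟨o, ho⟩ := exists_unitElt_eq_elt i
    exact ⟨_, ((leaf i).orientation.dual_elt_ne_zero_iff o).2 rfl,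
      ho.trans ((leaf i).orientation.elt_eq_smul o)⟩
  | node h s t hs ht =>
    obtain ⟨c, hc, ec⟩ := hs
    obtain ⟨d, hd, ed⟩ := ht
    obtain ⟨e, he, ee⟩ := opΩ_orientation_elt h s t
    refine ⟨c * d * e, mul_ne_zero (mul_ne_zero hc hd) he, ?_⟩
    rw [eval, ec, ed, TensorProduct.smul_tmul_smul, map_smul, ee, smul_smul]

theorem dual_eval_ne_zero_iff (t : TreeMonomial J) {F : Forest J} (o : F.Orientation) :
    o.dual t.eval ≠ 0 ↔ t.forest = F := by
  obtain ⟨c, hc, e⟩ := t.exists_eval_eq_smul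
  rw [e, map_smul, smul_ne_zero_iff_right hc, o.dual_elt_ne_zero_iff, eq_comm]

theorem exists_counit (t : TreeMonomial J) :
    ∃ (F : Forest J) (o : F.Orientation), F.support = ∅ ∧
      sliceLeft o.dual t.delta = t.eval ∧ sliceRight o.dual t.delta = t.eval := by
  induction t with
  | leaf i =>
    obtain ⟨o, ho⟩ := exists_unitElt_eq_elt i
    refine ⟨(leaf i).forest, o, ?_, ?_, ?_⟩
    · rw [← Forest.nontrivialTrees_eq_empty_iff]
      simp [Forest.nontrivialTrees, forest, tree, LTree.toForest, Finset.filter_singleton]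
    · rw [delta, eval, ho, sliceLeft_tmul, o.dual_elt_self, one_smul]
    · rw [delta, eval, ho, sliceRight_tmul, o.dual_elt_self, one_smul]
  | node h s t hs ht =>
    obtain ⟨F, o, hF, hleft, hright⟩ := hs
    obtain ⟨G, p, hG, hleft', hright'⟩ := ht
    refine ⟨F.union h G, o.union h p, ?_, ?_, ?_⟩
    · rw [Forest.support_union, hF, hG, Finset.union_empty]
    · rw [delta, eval, Forest.Orientation.sliceLeft_deltaΩ h hF hG, hleft, hleft']
    · rw [delta, eval, Forest.Orientation.sliceRight_deltaΩ h hF hG, hright, hright']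

theorem map_rescale_delta {c : ℚ} (hc : c ≠ 0) (t : TreeMonomial J) :
    TensorProduct.map (rescale c J) (rescale c J) t.delta = c ^ (3 * J.card + 1) • t.delta := by
  induction t with
  | leaf i =>
    have hunit : rescale c {i} (unitElt i) = c ^ 2 • unitElt i := rescale_elt c _
    rw [delta, TensorProduct.map_tmul, hunit, TensorProduct.smul_tmul_smul, ← pow_add,
      Finset.card_singleton]
  | node h s t hs ht =>
    refine smul_right_injective _ hc ?_
    dsimp only
    rw [delta, ← deltaΩ_rescale, hs, ht, TensorProduct.smul_tmul_smul, map_smul, smul_smul,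
      ← pow_add, ← pow_succ', Finset.card_union_of_disjoint h]
    congr 2
    ring

theorem dualDistrib_delta_ne_zero_iff_eq_right (t : TreeMonomial J) {F₁ F₂ : Forest J}
    (hF₁ : F₁.support = ∅) (o₁ : F₁.Orientation) (o₂ : F₂.Orientation) :
    TensorProduct.dualDistrib ℚ (Bess J) (Bess J) (o₁.dual ⊗ₜ o₂.dual) t.delta ≠ 0 ↔
      t.forest = F₂ := by
  obtain ⟨D, d, hD, hleft, -⟩ := t.exists_counit
  obtain rfl := Forest.eq_of_support_eq_empty hD hF₁
  have hc := (o₁.dual_elt_ne_zero_iff d).2 rfl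
  rw [d.dual_eq_smul o₁, ← TensorProduct.smul_tmul', map_smul, LinearMap.smul_apply,
    smul_ne_zero_iff_right hc, dualDistrib_eq_sliceLeft, hleft, t.dual_eval_ne_zero_iff]

theorem dualDistrib_delta_ne_zero_iff_eq_left (t : TreeMonomial J) {F₁ F₂ : Forest J}
    (hF₂ : F₂.support = ∅) (o₁ : F₁.Orientation) (o₂ : F₂.Orientation) :
    TensorProduct.dualDistrib ℚ (Bess J) (Bess J) (o₁.dual ⊗ₜ o₂.dual) t.delta ≠ 0 ↔
      t.forest = F₁ := by
  obtain ⟨D, d, hD, -, hright⟩ := t.exists_counit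
  obtain rfl := Forest.eq_of_support_eq_empty hD hF₂
  have hc := (o₂.dual_elt_ne_zero_iff d).2 rfl
  rw [d.dual_eq_smul o₂, TensorProduct.tmul_smul, map_smul, LinearMap.smul_apply,
    smul_ne_zero_iff_right hc, dualDistrib_eq_sliceRight, hright, t.dual_eval_ne_zero_iff]

theorem card_trees_add_of_dualDistrib_delta_ne_zero {t : TreeMonomial J} {F₁ F₂ : Forest J}
    {o₁ : F₁.Orientation} {o₂ : F₂.Orientation}
    (hne : TensorProduct.dualDistrib ℚ (Bess J) (Bess J) (o₁.dual ⊗ₜ o₂.dual) t.delta ≠ 0) :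
    F₁.trees.card + F₂.trees.card = J.card + 1 := by
  have hscale := congrArg (TensorProduct.dualDistrib ℚ (Bess J) (Bess J) (o₁.dual ⊗ₜ o₂.dual))
    (t.map_rescale_delta two_ne_zero)
  have hdual {F : Forest J} (o : F.Orientation) :
      o.dual ∘ₗ rescale 2 J = (2 : ℚ) ^ (J.card + F.trees.card) • o.dual :=
    LinearMap.ext (o.dual_rescale 2)
  rw [dualDistrib_map, hdual, hdual, TensorProduct.smul_tmul_smul, map_smul, map_smul,
    LinearMap.smul_apply, smul_eq_mul, smul_eq_mul, ← pow_add] at hscale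
  have hdeg := pow_right_injective₀ (two_pos (α := ℚ)) (by norm_num)
    (mul_right_cancel₀ hne hscale)
  omega

theorem dualDistrib_delta_ne_zero_iff (t : TreeMonomial J) {F₁ F₂ : Forest J}
    (h : Disjoint F₁.support F₂.support) (o₁ : F₁.Orientation) (o₂ : F₂.Orientation) :
    TensorProduct.dualDistrib ℚ (Bess J) (Bess J) (o₁.dual ⊗ₜ o₂.dual) t.delta ≠ 0 ↔
      t.forest.IsUnionOf F₁ F₂ := by
  rcases F₁.support.eq_empty_or_nonempty with hF₁ | hF₁
  · rw [t.dualDistrib_delta_ne_zero_iff_eq_right hF₁, Forest.isUnionOf_iff_eq_right hF₁]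
  rcases F₂.support.eq_empty_or_nonempty with hF₂ | hF₂
  · rw [t.dualDistrib_delta_ne_zero_iff_eq_left hF₂, Forest.isUnionOf_iff_eq_left hF₂]
  have hcard : F₁.trees.card + F₂.trees.card ≠ J.card + 1 := by
    have := Forest.card_lt_card_trees_add_card_support hF₁
    have := Forest.card_lt_card_trees_add_card_support hF₂
    have hsupp := Finset.card_le_card (Finset.union_subset F₁.support_subset F₂.support_subset)
    rw [Finset.card_union_of_disjoint h] at hsupp
    omega
  refine iff_of_false (mt card_trees_add_of_dualDistrib_delta_ne_zero hcard) fun hu => hcard ?_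
  rw [← hu.card_trees_add h, add_comm]
  congr 1

end TreeMonomial

namespace ForestMonomial

theorem exists_eval_eq_smul (t : ForestMonomial J) :
    ∃ (o : t.forest.Orientation) (c : ℚ), c ≠ 0 ∧ t.eval = c • o.elt := by
  induction t with
  | nil => exact ⟨_, 1, one_ne_zero, (one_smul ℚ emptyElt).symm⟩
  | cons h s t ih =>
    obtain ⟨c, hc, ec⟩ := s.exists_eval_eq_smul
    obtain ⟨p, d, hd, ed⟩ := ih
    refine ⟨s.orientation.union h p, c * d, mul_ne_zero hc hd, ?_⟩
    rw [eval, ec, ed, TensorProduct.smul_tmul_smul, map_smul, Forest.Orientation.opE_elt]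
    rfl

theorem dualDistrib_delta_cons_ne_zero_iff (h : Disjoint J K) (s : TreeMonomial J)
    (t : ForestMonomial K) {F₁ F₂ : Forest J} {G₁ G₂ : Forest K}
    (o₁ : (F₁.union h G₁).Orientation) (o₂ : (F₂.union h G₂).Orientation)
    (p₁ : F₁.Orientation) (p₂ : F₂.Orientation) (q₁ : G₁.Orientation) (q₂ : G₂.Orientation) :
    TensorProduct.dualDistrib ℚ (Bess (J ∪ K)) (Bess (J ∪ K)) (o₁.dual ⊗ₜ o₂.dual)
        (cons h s t).delta ≠ 0 ↔
      TensorProduct.dualDistrib ℚ (Bess J) (Bess J) (p₁.dual ⊗ₜ p₂.dual) s.delta ≠ 0 ∧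
        TensorProduct.dualDistrib ℚ (Bess K) (Bess K) (q₁.dual ⊗ₜ q₂.dual) t.delta ≠ 0 := by
  have hc₁ := (o₁.dual_elt_ne_zero_iff (p₁.union h q₁)).2 rfl
  have hc₂ := (o₂.dual_elt_ne_zero_iff (p₂.union h q₂)).2 rfl
  rw [(p₁.union h q₁).dual_eq_smul o₁, (p₂.union h q₂).dual_eq_smul o₂,
    TensorProduct.smul_tmul_smul, map_smul, LinearMap.smul_apply,
    smul_ne_zero_iff_right (mul_ne_zero hc₁ hc₂), delta, Forest.Orientation.dualDistrib_deltaE,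
    mul_ne_zero_iff_left (pow_ne_zero _ (by norm_num)), mul_ne_zero_iff]

theorem dualDistrib_delta_ne_zero_iff (t : ForestMonomial J) {F₁ F₂ : Forest J}
    (hdisj : Disjoint F₁.support F₂.support) (o₁ : F₁.Orientation) (o₂ : F₂.Orientation) :
    TensorProduct.dualDistrib ℚ (Bess J) (Bess J) (o₁.dual ⊗ₜ o₂.dual) t.delta ≠ 0 ↔
      t.forest.IsUnionOf F₁ F₂ := by
  induction t with
  | nil =>
    have hsupp (F : Forest (∅ : Finset ι)) : F.support = ∅ :=
      Finset.subset_empty.1 F.support_subset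
    have heq (F G : Forest (∅ : Finset ι)) : F = G :=
      Forest.eq_of_support_eq_empty (hsupp F) (hsupp G)
    refine iff_of_true ?_ ((Forest.isUnionOf_iff_eq_right (hsupp F₁)).2 (heq _ _))
    rw [delta, TensorProduct.dualDistrib_apply]
    exact mul_ne_zero ((o₁.dual_elt_ne_zero_iff _).2 (heq _ _))
      ((o₂.dual_elt_ne_zero_iff _).2 (heq _ _))
  | @cons J K h s t ih =>
    by_cases hF : (∃ (F : Forest J) (G : Forest K), F₁ = F.union h G) ∧
        ∃ (F : Forest J) (G : Forest K), F₂ = F.union h G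
    · obtain ⟨⟨F₁, G₁, rfl⟩, F₂, G₂, rfl⟩ := hF
      rw [Forest.support_union, Forest.support_union] at hdisj
      rw [dualDistrib_delta_cons_ne_zero_iff h s t o₁ o₂ (Classical.arbitrary _)
          (Classical.arbitrary _) (Classical.arbitrary _) (Classical.arbitrary _),
        s.dualDistrib_delta_ne_zero_iff
          (hdisj.mono Finset.subset_union_left Finset.subset_union_left),
        ih (hdisj.mono Finset.subset_union_right Finset.subset_union_right), forest,
        Forest.isUnionOf_union]
    · refine iff_of_false (not_not.2 ?_) (mt (Forest.IsUnionOf.exists_eq_union h) hF)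
      exact Forest.Orientation.dualDistrib_deltaE_eq_zero h ((not_and_or.1 hF).imp
        (o₁.dual_comp_opE_eq_zero h) (o₂.dual_comp_opE_eq_zero h)) _

end ForestMonomial

namespace Forest

theorem forest_monomial (F : Forest J) : F.monomial.forest = F := by
  obtain ⟨o, c, hc, e⟩ := F.monomial.exists_eval_eq_smul
  have hne : F.orientation.dual (c • o.elt) ≠ 0 := by
    rw [← e, F.eval_monomial, Orientation.dual_elt_self]
    exact one_ne_zero
  rw [map_smul, smul_ne_zero_iff_right hc, F.orientation.dual_elt_ne_zero_iff] at hne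
  exact hne.symm

theorem Orientation.coproduct_elt {F : Forest J} (o : F.Orientation) :
    coproduct J o.elt = F.orientation.dual o.elt • F.monomial.delta := by
  rw [coproduct, LinearMap.sum_apply, Finset.sum_eq_single F]
  · exact LinearMap.smulRight_apply _ _ _
  · intro G _ hG
    rw [LinearMap.smulRight_apply, G.orientation.dual_elt_of_ne o hG, zero_smul]
  · exact fun hF => absurd (Finset.mem_univ F) hF

theorem appears_dualMul_iff {F : Forest J} {f g : Module.Dual ℚ (Bess J)} :
    F.Appears (dualMul f g) ↔
      TensorProduct.dualDistrib ℚ (Bess J) (Bess J) (f ⊗ₜ g) F.monomial.delta ≠ 0 := by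
  have happ (o : F.Orientation) : dualMul f g o.elt ≠ 0 ↔
      TensorProduct.dualDistrib ℚ (Bess J) (Bess J) (f ⊗ₜ g) F.monomial.delta ≠ 0 := by
    rw [dualMul, LinearMap.comp_apply, o.coproduct_elt, map_smul,
      smul_ne_zero_iff_right ((F.orientation.dual_elt_ne_zero_iff o).2 rfl)]
  exact ⟨fun ⟨o, ho⟩ => (happ o).1 ho, fun hne => ⟨F.orientation, (happ _).2 hne⟩⟩

end Forest

end Coefficients

end Bessel

theorem mainTheorem8 {ι : Type*} [Fintype ι] [DecidableEq ι] (I : Finset ι)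
    (F₁ F₂ : Bessel.Forest I) (o₁ : F₁.Orientation) (o₂ : F₂.Orientation)
    (h : Disjoint F₁.support F₂.support) :
    (∃! F : Bessel.Forest I, F.IsUnionOf F₁ F₂) ∧
      ∀ F : Bessel.Forest I,
        F.Appears (Bessel.dualMul o₁.dual o₂.dual) ↔ F.IsUnionOf F₁ F₂ := by
  refine ⟨Bessel.Forest.existsUnique_isUnionOf h, fun F => ?_⟩
  rw [Bessel.Forest.appears_dualMul_iff, Bessel.ForestMonomial.dualDistrib_delta_ne_zero_iff _ h,
    Bessel.Forest.forest_monomial]
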